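/- Let $\Bbbk$ be an algebraically closed field of characteristic $0$ and let $n\ge 0$. The 0-Hecke-Clifford algebra $\mathcal{HC}_n$ is the unital associative $\Bbbk$-algebra generated by $T_1,\dots,T_{n-1}$ and $c_1,\dots,c_n$ with relations $T_i^2=-T_i$; $T_iT_j=T_jT_i$ for $|i-j|>1$; $T_iT_{i+1}T_i=T_{i+1}T_iT_{i+1}$; $c_i^2=-1$; $c_ic_j=-c_jc_i$ for $i\neq j$; $T_ic_j=c_jT_i$ for $j\neq i,i+1$; $T_ic_i=c_{i+1}T_i$; $(T_i+1)c_{i+1}=c_i(T_i+1)$. It is a superalgebra ($\mathbb Z_2$-graded algebra) with all $T_i$ even and all $c_j$ odd. For $D=\{i_1<\cdots<i_r\}\subseteq\{1,\dots,n\}$ put $c_D=c_{i_1}\cdots c_{i_r}$, and for $w\in\mathfrak S_n$ put $T_w=T_{j_1}\cdots T_{j_s}$ for any reduced expression $w=s_{j_1}\cdots s_{j_s}$ in the simple transpositions $s_i=(i,i+1)$. Let $w_0\in\mathfrak S_n$ be the longest element, $w_0(j)=n+1-j$. A finite dimensional superalgebra $A$ over $\Bbbk$ is a Frobenius superalgebra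 if it has a trace map, that is, an even linear map $tr:A\to\Bbbk$ (so $tr$ vanishes on the odd part) whose kernel contains no non-zero left ideal of $A$. An even algebra automorphism $\varphi$ of $A$ is the Nakayama automorphism corresponding to $tr$ if $tr(ab)=(-1)^{|a||b|}\,tr(\varphi(b)a)$ for all homogeneous $a,b\in A$. Then $\mathcal{HC}_n$ is a Frobenius superalgebra. There is exactly one linear map $tr_n:\mathcal{HC}_n\to\Bbbk$ with $$tr_n(c_DT_w)=\delta_{D,\emptyset}\,\delta_{w,w_0}\qquad(D\subseteq\{1,\dots,n\},\ w\in\mathfrak S_n),$$ and it is a trace map. The corresponding Nakayama automorphism is the involutive even algebra automorphism $\varphi$ of $\mathcal{HC}_n$ with $\varphi(T_i)=T_{n-i}+c_{n-i}c_{n+1-i}$ for $1\le i\le n-1$ and $\varphi(c_j)=-c_{n+1-j}$ for $1\le j\le n$; in particular such an automorphism exists. -/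

import Mathlib

/-! ### Frobenius superalgebras -/

section Frobenius

variable {k A : Type*} [Field k] [Ring A] [Algebra k A]

/-- A trace map on the superalgebra `A = 𝒜 0 ⊕ 𝒜 1`: an even linear form (it vanishes on the odd
part) whose kernel contains no non-zero left ideal. `Ideal A` is the type of left ideals. -/
structure IsFrobeniusTrace (𝒜 : ZMod 2 → Submodule k A) [GradedAlgebra 𝒜] (tr : A →ₗ[k] k) :
    Prop where
  even : ∀ a ∈ 𝒜 1, tr a = 0
  no_left_ideal : ∀ I : Ideal A, (∀ a ∈ I, tr a = 0) → I = ⊥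

/-- A Frobenius superalgebra: finite dimensional, with a trace map. -/
def IsFrobeniusSuperalgebra (𝒜 : ZMod 2 → Submodule k A) [GradedAlgebra 𝒜] : Prop :=
  FiniteDimensional k A ∧ ∃ tr : A →ₗ[k] k, IsFrobeniusTrace 𝒜 tr

/-- `φ` is a Nakayama automorphism for the form `(a, b) = tr (a b)`: an even algebra automorphism
with `(a, b) = (-1) ^ (|a| |b|) (φ b, a)` for all homogeneous `a`, `b`. -/
structure IsNakayamaAutomorphism (𝒜 : ZMod 2 → Submodule k A) [GradedAlgebra 𝒜]
    (tr : A →ₗ[k] k) (φ : A ≃ₐ[k] A) : Prop where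
  even : ∀ i, ∀ a ∈ 𝒜 i, φ a ∈ 𝒜 i
  trace_mul : ∀ i j : ZMod 2, ∀ a ∈ 𝒜 i, ∀ b ∈ 𝒜 j,
    tr (a * b) = (-1 : k) ^ (i.val * j.val) * tr (φ b * a)

end Frobenius

namespace HeckeClifford

/-! ### The 0-Hecke-Clifford algebra

Indices are shifted by one: `T i` for `i : Fin (n - 1)` is `T_{i+1}`, and `c j` for `j : Fin n`
is `c_{j+1}`. -/

/-- The position `i` of the adjacent pair `i, i + 1`. -/
def lo {n : ℕ} (i : Fin (n - 1)) : Fin n := ⟨i, by omega⟩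

/-- The position `i + 1` of the adjacent pair `i, i + 1`. -/
def hi {n : ℕ} (i : Fin (n - 1)) : Fin n := ⟨i + 1, by omega⟩

/-- Names of the generators. -/
inductive Gen (n : ℕ) : Type
  | T (i : Fin (n - 1)) : Gen n
  | c (j : Fin n) : Gen n

/-- Degrees of the generators: the `T i` are even, the `c j` are odd. -/
def Gen.deg {n : ℕ} : Gen n → ZMod 2
  | .T _ => 0
  | .c _ => 1

section Presentation

variable (k : Type*) [Field k] (n : ℕ)

/-- The generator `T i` of the free algebra. -/
abbrev fT (i : Fin (n - 1)) : FreeAlgebra k (Gen n) := FreeAlgebra.ι k (Gen.T i)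

/-- The generator `c j` of the free algebra. -/
abbrev fc (j : Fin n) : FreeAlgebra k (Gen n) := FreeAlgebra.ι k (Gen.c j)

/-- The defining relations. -/
inductive Rel : FreeAlgebra k (Gen n) → FreeAlgebra k (Gen n) → Prop
  | T_sq (i : Fin (n - 1)) : Rel (fT k n i * fT k n i) (-fT k n i)
  | T_comm (i j : Fin (n - 1)) (h : (i : ℕ) + 1 < j ∨ (j : ℕ) + 1 < i) :
      Rel (fT k n i * fT k n j) (fT k n j * fT k n i)
  | T_braid (i j : Fin (n - 1)) (h : (j : ℕ) = i + 1) :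
      Rel (fT k n i * fT k n j * fT k n i) (fT k n j * fT k n i * fT k n j)
  | c_sq (j : Fin n) : Rel (fc k n j * fc k n j) (-1)
  | c_anticomm (i j : Fin n) (h : i ≠ j) : Rel (fc k n i * fc k n j) (-(fc k n j * fc k n i))
  | T_c_far (i : Fin (n - 1)) (j : Fin n) (h₁ : j ≠ lo i) (h₂ : j ≠ hi i) :
      Rel (fT k n i * fc k n j) (fc k n j * fT k n i)
  | T_c_lo (i : Fin (n - 1)) : Rel (fT k n i * fc k n (lo i)) (fc k n (hi i) * fT k n i)
  | T_c_hi (i : Fin (n - 1)) :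
      Rel ((fT k n i + 1) * fc k n (hi i)) (fc k n (lo i) * (fT k n i + 1))

/-- The 0-Hecke-Clifford algebra. -/
abbrev HC : Type _ := RingQuot (Rel k n)

variable {n}

/-- The image of a generator in the algebra. -/
noncomputable def gen (g : Gen n) : HC k n := RingQuot.mkAlgHom k (Rel k n) (FreeAlgebra.ι k g)

/-- The generator `T i`. -/
noncomputable def T (i : Fin (n - 1)) : HC k n := gen k (Gen.T i)

/-- The generator `c j`. -/
noncomputable def c (j : Fin n) : HC k n := gen k (Gen.c j)

/-- `c_D`, the product of the `c j` with `j ∈ D` in increasing order. -/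
noncomputable def cProd (D : Finset (Fin n)) : HC k n := (D.sort.map (c k)).prod

/-- `T_{j_1} ⋯ T_{j_s}` for the word `l = [j_1, …, j_s]`. -/
noncomputable def TProd (l : List (Fin (n - 1))) : HC k n := (l.map (T k)).prod

end Presentation

/-! ### Reduced expressions in the symmetric group -/

/-- The simple transposition `s_i = (i, i + 1)`. -/
def simpleRefl {n : ℕ} (i : Fin (n - 1)) : Equiv.Perm (Fin n) := Equiv.swap (lo i) (hi i)

/-- `l = [j_1, …, j_s]` is a reduced expression of `w`: `w = s_{j_1} ⋯ s_{j_s}`, and no shorter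
word in the simple transpositions has product `w`. -/
def IsReducedExpr {n : ℕ} (l : List (Fin (n - 1))) (w : Equiv.Perm (Fin n)) : Prop :=
  (l.map simpleRefl).prod = w ∧
    ∀ l' : List (Fin (n - 1)), (l'.map simpleRefl).prod = w → l.length ≤ l'.length

/-- The longest element of the symmetric group, `w_0(j) = n + 1 - j` for `j = 1, …, n`. -/
def longest (n : ℕ) : Equiv.Perm (Fin n) := Fin.revPerm

/-- The values prescribed for the trace: `tr (c_D T_w) = δ_{D,∅} δ_{w,w_0}`, where `T_w` may be
computed from any reduced expression of `w`. -/
def HasTraceValues {k : Type*} [Field k] {n : ℕ} (tr : HC k n →ₗ[k] k) : Prop :=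
  ∀ (D : Finset (Fin n)) (w : Equiv.Perm (Fin n)) (l : List (Fin (n - 1))), IsReducedExpr l w →
    tr (cProd k D * TProd k l) = if D = ∅ ∧ w = longest n then 1 else 0

/-! ### The super grading -/

section Grading

variable (k : Type*) [Field k] (n : ℕ)

/-- The homogeneous component of degree `d`: the span of the monomials in the generators whose
degrees add up to `d`. -/
noncomputable def parity (d : ZMod 2) : Submodule k (HC k n) :=
  Submodule.span k {x | ∃ l : List (Gen n), (l.map Gen.deg).sum = d ∧ (l.map (gen k)).prod = x}

variable {n}

theorem prod_mem_parity (l : List (Gen n)) :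
    (l.map (gen k)).prod ∈ parity k n (l.map Gen.deg).sum :=
  Submodule.subset_span ⟨l, rfl, rfl⟩

theorem gen_mem_parity (g : Gen n) : gen k g ∈ parity k n g.deg := by
  simpa using prod_mem_parity k [g]

variable (n)

instance parity_gradedMonoid : SetLike.GradedMonoid (parity k n) where
  one_mem := by simpa using prod_mem_parity k ([] : List (Gen n))
  mul_mem i j x y hx hy := by
    have h : parity k n i * parity k n j ≤ parity k n (i + j) := by
      rw [parity, parity, Submodule.span_mul_span]
      refine Submodule.span_le.2 ?_
      rintro _ ⟨_, ⟨l, rfl, rfl⟩, _, ⟨l', rfl, rfl⟩, rfl⟩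
      simpa using prod_mem_parity k (l ++ l')
    exact h (Submodule.mul_mem_mul hx hy)

open scoped DirectSum

variable {n}

/-- A generator, placed in its component of the direct sum. -/
noncomputable def gradedGen (g : Gen n) : ⨁ d, parity k n d :=
  DirectSum.of (fun d => parity k n d) g.deg ⟨gen k g, gen_mem_parity k g⟩

/-- The free algebra mapped to the direct sum of the components, generator by generator. -/
noncomputable def freeDecompose : FreeAlgebra k (Gen n) →ₐ[k] ⨁ d, parity k n d :=
  FreeAlgebra.lift k (gradedGen k)

/-- `freeDecompose` sends `x` into the component of degree `d`. -/
def IsHomog (d : ZMod 2) (x : FreeAlgebra k (Gen n)) : Prop :=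
  ∃ h : RingQuot.mkAlgHom k (Rel k n) x ∈ parity k n d,
    freeDecompose k x = DirectSum.of (fun d => parity k n d) d ⟨_, h⟩

variable {k}

theorem IsHomog.gen (g : Gen n) : IsHomog k g.deg (FreeAlgebra.ι k g) :=
  ⟨gen_mem_parity k g, by simp [freeDecompose, gradedGen, HeckeClifford.gen]⟩

theorem IsHomog.T (i : Fin (n - 1)) : IsHomog k 0 (fT k n i) := IsHomog.gen (Gen.T i)

theorem IsHomog.c (j : Fin n) : IsHomog k 1 (fc k n j) := IsHomog.gen (Gen.c j)

theorem IsHomog.one : IsHomog k 0 (1 : FreeAlgebra k (Gen n)) := by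
  refine ⟨by rw [map_one]; exact SetLike.GradedOne.one_mem, ?_⟩
  rw [map_one, DirectSum.one_def]
  exact DirectSum.of_eq_of_gradedMonoid_eq (Sigma.subtype_ext rfl (map_one _).symm)

theorem IsHomog.mul {d e : ZMod 2} {x y : FreeAlgebra k (Gen n)} (hx : IsHomog k d x)
    (hy : IsHomog k e y) : IsHomog k (d + e) (x * y) := by
  obtain ⟨hx, hx'⟩ := hx
  obtain ⟨hy, hy'⟩ := hy
  refine ⟨by rw [map_mul]; exact SetLike.GradedMul.mul_mem hx hy, ?_⟩
  rw [map_mul, hx', hy', DirectSum.of_mul_of]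
  exact DirectSum.of_eq_of_gradedMonoid_eq (Sigma.subtype_ext rfl (map_mul _ _ _).symm)

theorem IsHomog.add {d : ZMod 2} {x y : FreeAlgebra k (Gen n)} (hx : IsHomog k d x)
    (hy : IsHomog k d y) : IsHomog k d (x + y) := by
  obtain ⟨hx, hx'⟩ := hx
  obtain ⟨hy, hy'⟩ := hy
  refine ⟨by rw [map_add]; exact add_mem hx hy, ?_⟩
  rw [map_add, hx', hy', ← map_add]
  exact DirectSum.of_eq_of_gradedMonoid_eq (Sigma.subtype_ext rfl (map_add _ _ _).symm)

theorem IsHomog.neg {d : ZMod 2} {x : FreeAlgebra k (Gen n)} (hx : IsHomog k d x) :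
    IsHomog k d (-x) := by
  obtain ⟨hx, hx'⟩ := hx
  rw [← neg_one_smul k x]
  refine ⟨by rw [map_smul]; exact Submodule.smul_mem _ _ hx, ?_⟩
  rw [map_smul, hx', ← DirectSum.lof_eq_of k, ← map_smul, DirectSum.lof_eq_of]
  exact DirectSum.of_eq_of_gradedMonoid_eq (Sigma.subtype_ext rfl (map_smul _ _ _).symm)

/-- Two homogeneous elements of equal degree that are related have the same image. -/
theorem IsHomog.eq_of_rel {d e : ZMod 2} {x y : FreeAlgebra k (Gen n)} (hx : IsHomog k d x)
    (hy : IsHomog k e y) (hde : d = e) (h : Rel k n x y) :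
    freeDecompose k x = freeDecompose k y := by
  subst hde
  obtain ⟨hx, hx'⟩ := hx
  obtain ⟨hy, hy'⟩ := hy
  rw [hx', hy']
  exact DirectSum.of_eq_of_gradedMonoid_eq
    (Sigma.subtype_ext rfl (RingQuot.mkAlgHom_rel k h))

theorem freeDecompose_rel {x y : FreeAlgebra k (Gen n)} (h : Rel k n x y) :
    freeDecompose k x = freeDecompose k y := by
  cases h with
  | T_sq i => exact ((IsHomog.T i).mul (.T i)).eq_of_rel (IsHomog.T i).neg rfl (.T_sq i)
  | T_comm i j h =>
    exact ((IsHomog.T i).mul (.T j)).eq_of_rel ((IsHomog.T j).mul (.T i)) rfl (.T_comm i j h)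
  | T_braid i j h =>
    exact (((IsHomog.T i).mul (.T j)).mul (.T i)).eq_of_rel
      (((IsHomog.T j).mul (.T i)).mul (.T j)) rfl (.T_braid i j h)
  | c_sq j => exact ((IsHomog.c j).mul (.c j)).eq_of_rel IsHomog.one.neg rfl (.c_sq j)
  | c_anticomm i j h =>
    exact ((IsHomog.c i).mul (.c j)).eq_of_rel ((IsHomog.c j).mul (.c i)).neg rfl
      (.c_anticomm i j h)
  | T_c_far i j h₁ h₂ =>
    exact ((IsHomog.T i).mul (.c j)).eq_of_rel ((IsHomog.c j).mul (.T i)) rfl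
      (.T_c_far i j h₁ h₂)
  | T_c_lo i =>
    exact ((IsHomog.T i).mul (.c _)).eq_of_rel ((IsHomog.c _).mul (.T i)) rfl (.T_c_lo i)
  | T_c_hi i =>
    exact (((IsHomog.T i).add .one).mul (.c _)).eq_of_rel
      ((IsHomog.c _).mul ((IsHomog.T i).add .one)) rfl (.T_c_hi i)

variable (k n)

/-- The decomposition of an element into its homogeneous components. -/
noncomputable def decomposeHom : HC k n →ₐ[k] ⨁ d, parity k n d :=
  RingQuot.liftAlgHom k ⟨freeDecompose k, fun _ _ h => freeDecompose_rel h⟩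

variable {n}

theorem decomposeHom_gen (g : Gen n) : decomposeHom k n (gen k g) = gradedGen k g := by
  simp [decomposeHom, gen, freeDecompose]

theorem decomposeHom_prod (l : List (Gen n)) :
    decomposeHom k n (l.map (gen k)).prod =
      DirectSum.of (fun d => parity k n d) _ ⟨_, prod_mem_parity k l⟩ := by
  induction l with
  | nil =>
    exact (map_one _).trans (DirectSum.one_def _)
  | cons g l ih =>
    simp only [List.map_cons, List.prod_cons, map_mul]
    rw [ih, decomposeHom_gen, gradedGen, DirectSum.of_mul_of]
    exact DirectSum.of_eq_of_gradedMonoid_eq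
      (Sigma.subtype_ext (by simp [GradedMonoid.mk]) (by simp [GradedMonoid.mk]))

theorem decomposeHom_coe (d : ZMod 2) (x : parity k n d) :
    decomposeHom k n x = DirectSum.of (fun d => parity k n d) d x := by
  obtain ⟨x, hx⟩ := x
  induction hx using Submodule.span_induction with
  | mem x h =>
    obtain ⟨l, rfl, rfl⟩ := h
    exact decomposeHom_prod k l
  | zero => simp only [map_zero]; exact (map_zero (DirectSum.of (fun d => parity k n d) d)).symm
  | add x y hx hy ihx ihy => rw [map_add, ihx, ihy, ← map_add]; rfl
  | smul r x hx ih =>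
    simp only at ih
    rw [map_smul, ih, ← DirectSum.lof_eq_of k, ← map_smul]
    rfl

variable (n)

/-- The 0-Hecke-Clifford algebra is a superalgebra with `T i` even and `c j` odd. -/
noncomputable instance parity_gradedAlgebra : GradedAlgebra (parity k n) :=
  GradedAlgebra.ofAlgHom (parity k n) (decomposeHom k n)
    (by
      refine RingQuot.ringQuot_ext' k _ _ (FreeAlgebra.hom_ext (funext fun g => ?_))
      change DirectSum.coeAlgHom (parity k n) (decomposeHom k n (gen k g)) = gen k g
      rw [decomposeHom_gen, gradedGen, DirectSum.coeAlgHom_of])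
    (decomposeHom_coe k)

end Grading

end HeckeClifford

namespace HeckeClifford

/-! ### Inversions and reduced expressions in the symmetric group -/

section SymmetricGroup

variable {n : ℕ}

/-! The algebra is free as a left module over the Clifford algebra, with basis the `T_w`. The trace
reads off the coefficient of `T_{w₀}` and then its constant term, and everything reduces to this
basis and to a symmetric nondegenerate form on the Clifford algebra.

Basis. Commuting `T_i` past a Clifford element `x` gives `T_i x = s_i(x) T_i + der_i(x)`, where
`der_i(x) = s_i(x) u - u x` with `u = (1 + e_i e_{i+1}) / 2`. This dictates how `T_i` must act on
formal sums `∑ f(w) T_w`. That the formulas define a representation (`reg_hcRelations`) is checked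
economically: each defect of a relation among the `T_i` commutes with the Clifford action up to
renumbering generators, so it suffices to kill it on scalar functions (`eq_zero_of_scalar`), where
the formulas describe the 0-Hecke algebra. Applying an element to the vector `T_1` gives its
coordinates, and summing them back recovers the element (`fromReg_toReg`).

Nondegeneracy. If the trace kills a left ideal, the coordinates of its elements at `w₀` vanish,
because the constant-term form is nondegenerate (`eq_zero_of_coeffOne`). Multiplying by `T_i` raises
a coordinate at `w` to one at `s_i w`, so descending induction on length kills all of them.

Nakayama automorphism. The relations survive the twist (`HCRelations.twist`), so the automorphism
exists. The trace identity passes from generators to words, so only `a c_j` and `a T_i` matter. For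
`c_j`, one has `T_w c_j = c_{w(j)} T_w` modulo shorter terms, and only `w₀` counts. For `T_i`, the
corrections `c_{n-i} c_{n+1-i}` cancel exactly the constant term contributed by `der`
(`coeffOne_der`). -/

theorem lo_lt_hi (i : Fin (n - 1)) : lo i < hi i := by
  simp [lo, hi, Fin.lt_def]

theorem lo_ne_hi (i : Fin (n - 1)) : lo i ≠ hi i := (lo_lt_hi i).ne

theorem simpleRefl_lo (i : Fin (n - 1)) : simpleRefl i (lo i) = hi i := Equiv.swap_apply_left _ _

theorem simpleRefl_hi (i : Fin (n - 1)) : simpleRefl i (hi i) = lo i := Equiv.swap_apply_right _ _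

theorem simpleRefl_of_ne {i : Fin (n - 1)} {j : Fin n} (h₁ : j ≠ lo i) (h₂ : j ≠ hi i) :
    simpleRefl i j = j := Equiv.swap_apply_of_ne_of_ne h₁ h₂

theorem simpleRefl_inv (i : Fin (n - 1)) : (simpleRefl i)⁻¹ = simpleRefl i := Equiv.swap_inv _ _

@[simp] theorem simpleRefl_mul_self (i : Fin (n - 1)) : simpleRefl i * simpleRefl i = 1 :=
  Equiv.swap_mul_self _ _

@[simp] theorem simpleRefl_mul_cancel (i : Fin (n - 1)) (w : Equiv.Perm (Fin n)) :
    simpleRefl i * (simpleRefl i * w) = w := by rw [← mul_assoc, simpleRefl_mul_self, one_mul]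

@[simp] theorem simpleRefl_apply_self (i : Fin (n - 1)) (j : Fin n) :
    simpleRefl i (simpleRefl i j) = j := Equiv.swap_apply_self _ _ _

theorem simpleRefl_lt_simpleRefl {i : Fin (n - 1)} {p q : Fin n} (h : ¬(p = lo i ∧ q = hi i))
    (h' : p < q) : simpleRefl i p < simpleRefl i q := by
  simp only [simpleRefl, Equiv.swap_apply_def, lo, hi, Fin.ext_iff, Fin.lt_def] at *
  split_ifs <;> (try dsimp only at *) <;> omega

theorem hi_eq_lo {i j : Fin (n - 1)} (h : (j : ℕ) = i + 1) : hi i = lo j := by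
  simp [lo, hi, h]

theorem simpleRefl_comm {i j : Fin (n - 1)} (h : (i : ℕ) + 1 < j ∨ (j : ℕ) + 1 < i) :
    simpleRefl i * simpleRefl j = simpleRefl j * simpleRefl i := by
  refine (Equiv.Perm.Disjoint.commute fun p => ?_).eq
  by_cases hp : p = lo i ∨ p = hi i
  · right
    apply simpleRefl_of_ne <;> rcases hp with rfl | rfl <;>
      simp only [lo, hi, ne_eq, Fin.ext_iff] <;> omega
  · left
    rw [not_or] at hp
    exact simpleRefl_of_ne hp.1 hp.2

theorem simpleRefl_braid {i j : Fin (n - 1)} (h : (j : ℕ) = i + 1) :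
    simpleRefl i * (simpleRefl j * simpleRefl i) =
      simpleRefl j * (simpleRefl i * simpleRefl j) := by
  have h₁ : lo i ≠ hi j := by simp only [lo, hi, ne_eq, Fin.ext_iff]; omega
  have h₂ : lo i ≠ lo j := by simp only [lo, ne_eq, Fin.ext_iff]; omega
  simp only [simpleRefl, hi_eq_lo h, ← mul_assoc]
  rw [Equiv.swap_mul_swap_mul_swap h₂ h₁, Equiv.swap_comm (lo i), Equiv.swap_comm (lo j) (hi j),
    Equiv.swap_mul_swap_mul_swap (lo_ne_hi j).symm h₁.symm, Equiv.swap_comm]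

/-- `i` is a left descent of `w`: the length of `s_i w` is smaller than that of `w`. -/
def IsDescent (i : Fin (n - 1)) (w : Equiv.Perm (Fin n)) : Prop := w⁻¹ (hi i) < w⁻¹ (lo i)

instance (i : Fin (n - 1)) (w : Equiv.Perm (Fin n)) : Decidable (IsDescent i w) :=
  inferInstanceAs (Decidable (_ < _))

/-- The inversions of `w`, recorded by values. -/
def inversions (w : Equiv.Perm (Fin n)) : Finset (Fin n × Fin n) :=
  Finset.univ.filter fun x => x.1 < x.2 ∧ w⁻¹ x.2 < w⁻¹ x.1

/-- The number of inversions of `w`. -/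
def inv (w : Equiv.Perm (Fin n)) : ℕ := (inversions w).card

/-! ### Effect of a simple transposition on descents and inversions. -/

theorem inv_simpleRefl_mul_apply (i : Fin (n - 1)) (w : Equiv.Perm (Fin n)) (p : Fin n) :
    (simpleRefl i * w)⁻¹ p = w⁻¹ (simpleRefl i p) := by
  rw [mul_inv_rev, simpleRefl_inv, Equiv.Perm.mul_apply]

theorem not_isDescent_iff {i : Fin (n - 1)} {w : Equiv.Perm (Fin n)} :
    ¬IsDescent i w ↔ w⁻¹ (lo i) < w⁻¹ (hi i) := by
  rw [IsDescent, not_lt]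
  exact ⟨fun h => lt_of_le_of_ne h fun e => lo_ne_hi i (w⁻¹.injective e), le_of_lt⟩

theorem isDescent_simpleRefl_mul {i : Fin (n - 1)} {w : Equiv.Perm (Fin n)} :
    IsDescent i (simpleRefl i * w) ↔ ¬IsDescent i w := by
  rw [not_isDescent_iff, IsDescent, inv_simpleRefl_mul_apply, inv_simpleRefl_mul_apply,
    simpleRefl_lo, simpleRefl_hi]

/-- A simple transposition preserves the order of every pair of values except `(lo i, hi i)`, so it
carries the old inversions to inversions and creates exactly one more. -/
theorem inversions_simpleRefl_mul {i : Fin (n - 1)} {w : Equiv.Perm (Fin n)}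
    (h : ¬IsDescent i w) :
    inversions (simpleRefl i * w) = insert (lo i, hi i)
      ((inversions w).map ((simpleRefl i).prodCongr (simpleRefl i)).toEmbedding) := by
  have hd := not_isDescent_iff.1 h
  ext ⟨p, q⟩
  simp only [inversions, Finset.mem_insert, Finset.mem_map, Finset.mem_filter, Finset.mem_univ,
    true_and, inv_simpleRefl_mul_apply, Prod.mk.injEq, Equiv.coe_toEmbedding,
    Equiv.prodCongr_apply, Prod.exists, Prod.map_apply]
  constructor
  · rintro ⟨h₁, h₂⟩
    by_cases e : p = lo i ∧ q = hi i
    · exact .inl e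
    · exact .inr ⟨_, _, ⟨simpleRefl_lt_simpleRefl e h₁, h₂⟩, simpleRefl_apply_self _ _,
        simpleRefl_apply_self _ _⟩
  · rintro (⟨rfl, rfl⟩ | ⟨a, b, ⟨h₁, h₂⟩, rfl, rfl⟩)
    · exact ⟨lo_lt_hi i, by rwa [simpleRefl_lo, simpleRefl_hi]⟩
    · rw [simpleRefl_apply_self, simpleRefl_apply_self]
      refine ⟨simpleRefl_lt_simpleRefl ?_ h₁, h₂⟩
      rintro ⟨rfl, rfl⟩
      exact absurd h₂ hd.asymm

theorem inv_simpleRefl_mul_of_not {i : Fin (n - 1)} {w : Equiv.Perm (Fin n)}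
    (h : ¬IsDescent i w) : inv (simpleRefl i * w) = inv w + 1 := by
  rw [inv, inversions_simpleRefl_mul h, Finset.card_insert_of_notMem, Finset.card_map, inv]
  simp only [inversions, Finset.mem_map, Finset.mem_filter, Finset.mem_univ,
    true_and, Prod.mk.injEq, Equiv.coe_toEmbedding,
    Equiv.prodCongr_apply, Prod.exists, Prod.map_apply]
  rintro ⟨a, b, ⟨h₁, -⟩, ha, hb⟩
  rw [← simpleRefl_hi, (simpleRefl i).injective.eq_iff] at ha
  rw [← simpleRefl_lo, (simpleRefl i).injective.eq_iff] at hb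
  subst ha hb
  exact absurd h₁ (lo_lt_hi i).asymm

theorem inv_simpleRefl_mul_of_isDescent {i : Fin (n - 1)} {w : Equiv.Perm (Fin n)}
    (h : IsDescent i w) : inv (simpleRefl i * w) + 1 = inv w := by
  have := inv_simpleRefl_mul_of_not (i := i) (w := simpleRefl i * w)
    (by rwa [isDescent_simpleRefl_mul, not_not])
  rwa [simpleRefl_mul_cancel, eq_comm] at this

theorem inv_simpleRefl_mul_le (i : Fin (n - 1)) (w : Equiv.Perm (Fin n)) :
    inv (simpleRefl i * w) ≤ inv w + 1 := by
  by_cases h : IsDescent i w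
  · have := inv_simpleRefl_mul_of_isDescent h; omega
  · exact (inv_simpleRefl_mul_of_not h).le

@[simp] theorem inv_one : inv (1 : Equiv.Perm (Fin n)) = 0 := by
  simp only [inv, inversions, Finset.card_eq_zero, Finset.filter_eq_empty_iff]
  rintro x - ⟨h₁, h₂⟩
  exact absurd h₁ (by simpa using h₂.le)

/-! ### The identity and the longest element, characterised by descents. -/

theorem strictMono_of_lo_lt_hi {f : Fin n → Fin n} (h : ∀ i, f (lo i) < f (hi i)) :
    StrictMono f := by
  cases n with
  | zero => exact fun a => a.elim0
  | succ n => exact Fin.strictMono_iff_lt_succ.2 fun i => h i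

/-- The finite chain `Fin n` has only one order automorphism. -/
theorem eq_id_of_strictMono {f : Fin n → Fin n} (h : StrictMono f) (p : Fin n) : f p = p := by
  have := Subsingleton.elim
    (h.orderIsoOfSurjective f (Finite.injective_iff_surjective.1 h.injective)) (OrderIso.refl _)
  exact congrArg (fun e : Fin n ≃o Fin n => e p) this

theorem exists_isDescent {w : Equiv.Perm (Fin n)} (h : w ≠ 1) : ∃ i, IsDescent i w := by
  by_contra! h'
  refine h (inv_injective (Equiv.ext fun p => ?_))
  exact eq_id_of_strictMono (strictMono_of_lo_lt_hi fun i => not_isDescent_iff.1 (h' i)) p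

theorem exists_not_isDescent {w : Equiv.Perm (Fin n)} (h : w ≠ longest n) :
    ∃ i, ¬IsDescent i w := by
  by_contra! h'
  refine h (inv_injective (Equiv.ext fun p => ?_))
  -- If every `i` is a descent, `w⁻¹` is decreasing, so composing with the reversal gives an
  -- increasing map.
  have := eq_id_of_strictMono (f := fun p => Fin.rev (w⁻¹ p))
    (strictMono_of_lo_lt_hi fun i => Fin.rev_lt_rev.2 (h' i)) p
  have h₂ : w⁻¹ p = Fin.rev p := (Fin.rev_eq_iff).1 this
  rw [h₂, longest, eq_comm, Equiv.Perm.inv_eq_iff_eq]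
  simp

theorem longest_inv : (longest n)⁻¹ = longest n := by
  ext p; rw [longest, Equiv.Perm.inv_eq_iff_eq.2]; simp

theorem isDescent_longest (i : Fin (n - 1)) : IsDescent i (longest n) := by
  rw [IsDescent, longest_inv]
  exact Fin.rev_lt_rev.2 (lo_lt_hi i)

/-- The product of the simple transpositions of a word. -/
def wordProd (l : List (Fin (n - 1))) : Equiv.Perm (Fin n) := (l.map simpleRefl).prod

@[simp] theorem wordProd_nil : wordProd ([] : List (Fin (n - 1))) = 1 := rfl

@[simp] theorem wordProd_cons (i : Fin (n - 1)) (l : List (Fin (n - 1))) :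
    wordProd (i :: l) = simpleRefl i * wordProd l := rfl

theorem inv_wordProd_le (l : List (Fin (n - 1))) : inv (wordProd l) ≤ l.length := by
  induction l with
  | nil => simp
  | cons i l ih => exact (inv_simpleRefl_mul_le _ _).trans (Nat.succ_le_succ ih)

theorem exists_word (w : Equiv.Perm (Fin n)) : ∃ l, wordProd l = w ∧ l.length = inv w := by
  induction h : inv w generalizing w with
  | zero =>
    by_cases hw : w = 1
    · exact ⟨[], by simp [hw]⟩
    · obtain ⟨i, hi⟩ := exists_isDescent hw
      have := inv_simpleRefl_mul_of_isDescent hi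
      omega
  | succ m ih =>
    have hw : w ≠ 1 := by rintro rfl; simp at h
    obtain ⟨i, hi⟩ := exists_isDescent hw
    have := inv_simpleRefl_mul_of_isDescent hi
    obtain ⟨l, hl, hl'⟩ := ih (simpleRefl i * w) (by omega)
    exact ⟨i :: l, by simp [hl], by simp [hl']⟩

/-- Each letter changes the number of inversions by one, which bounds word length from below;
removing descents one at a time attains the bound. Minimality thus becomes a numerical condition. -/
theorem isReducedExpr_iff {l : List (Fin (n - 1))} {w : Equiv.Perm (Fin n)} :
    IsReducedExpr l w ↔ wordProd l = w ∧ l.length = inv w := by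
  constructor
  · rintro ⟨h₁, h₂⟩
    obtain ⟨l', hl, hl'⟩ := exists_word w
    exact ⟨h₁, le_antisymm (hl' ▸ h₂ l' hl) (by rw [← h₁]; exact inv_wordProd_le l)⟩
  · rintro ⟨h₁, h₂⟩
    exact ⟨h₁, fun l' hl' => by rw [h₂, ← hl']; exact inv_wordProd_le l'⟩

theorem exists_isReducedExpr (w : Equiv.Perm (Fin n)) : ∃ l, IsReducedExpr l w :=
  (exists_word w).imp fun _ => isReducedExpr_iff.2

theorem isReducedExpr_cons_iff {i : Fin (n - 1)} {l : List (Fin (n - 1))}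
    {w : Equiv.Perm (Fin n)} :
    IsReducedExpr (i :: l) w ↔ IsReducedExpr l (simpleRefl i * w) ∧ IsDescent i w := by
  simp only [isReducedExpr_iff, wordProd_cons, List.length_cons]
  constructor
  · rintro ⟨rfl, h⟩
    have h₁ := inv_wordProd_le l
    have h₂ : IsDescent i (simpleRefl i * wordProd l) := by
      rw [isDescent_simpleRefl_mul]
      intro h'
      have := inv_simpleRefl_mul_of_isDescent h'
      omega
    have := inv_simpleRefl_mul_of_isDescent h₂
    rw [simpleRefl_mul_cancel] at this ⊢
    exact ⟨⟨rfl, by omega⟩, h₂⟩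
  · rintro ⟨⟨h₁, h₂⟩, h₃⟩
    have := inv_simpleRefl_mul_of_isDescent h₃
    exact ⟨by rw [h₁, simpleRefl_mul_cancel], by omega⟩

theorem IsReducedExpr.cons {i : Fin (n - 1)} {l : List (Fin (n - 1))} {w : Equiv.Perm (Fin n)}
    (h : IsReducedExpr l w) (hi : ¬IsDescent i w) : IsReducedExpr (i :: l) (simpleRefl i * w) :=
  isReducedExpr_cons_iff.2 ⟨by rwa [simpleRefl_mul_cancel], isDescent_simpleRefl_mul.2 hi⟩

theorem wordProd_reverse (l : List (Fin (n - 1))) : wordProd l.reverse = (wordProd l)⁻¹ := by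
  simp only [wordProd, List.prod_inv_reverse, List.map_reverse, List.map_map]
  congr 2

theorem IsReducedExpr.reverse {l : List (Fin (n - 1))} {w : Equiv.Perm (Fin n)}
    (h : IsReducedExpr l w) : IsReducedExpr l.reverse w⁻¹ := by
  refine ⟨(wordProd_reverse l).trans (congrArg _ h.1), fun l' hl' => ?_⟩
  have := h.2 l'.reverse ((wordProd_reverse l').trans (by rw [wordProd, hl', inv_inv]))
  simpa using this

theorem IsDescent.simpleRefl_mul_of_far {i j : Fin (n - 1)} {w : Equiv.Perm (Fin n)}
    (h : (i : ℕ) + 1 < j ∨ (j : ℕ) + 1 < i) (hj : IsDescent j w) :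
    IsDescent j (simpleRefl i * w) := by
  rw [IsDescent, inv_simpleRefl_mul_apply, inv_simpleRefl_mul_apply, simpleRefl_of_ne,
    simpleRefl_of_ne]
  · exact hj
  all_goals simp only [lo, hi, ne_eq, Fin.ext_iff]; omega

/-- A family of elements of a monoid satisfying the braid relations has the same product over any
two reduced expressions of a permutation. -/
theorem prod_eq_of_isReducedExpr {M : Type*} [Monoid M] (t : Fin (n - 1) → M)
    (hcomm : ∀ i j : Fin (n - 1), (i : ℕ) + 1 < j ∨ (j : ℕ) + 1 < i → t i * t j = t j * t i)
    (hbraid : ∀ i j : Fin (n - 1), (j : ℕ) = i + 1 → t i * t j * t i = t j * t i * t j)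
    {l l' : List (Fin (n - 1))} {w : Equiv.Perm (Fin n)} (hl : IsReducedExpr l w)
    (hl' : IsReducedExpr l' w) : (l.map t).prod = (l'.map t).prod := by
  have main : ∀ (m : ℕ) (l l' : List (Fin (n - 1))) (w : Equiv.Perm (Fin n)), inv w = m →
      IsReducedExpr l w → IsReducedExpr l' w → (l.map t).prod = (l'.map t).prod := by
    intro m
    induction m using Nat.strong_induction_on with
    | _ m ih =>
      intro l l' w hm hl hl'
      have hlen := (isReducedExpr_iff.1 hl).2.trans (isReducedExpr_iff.1 hl').2.symm
      match l, l' with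
      | [], [] => rfl
      | [], _ :: _ => simp at hlen
      | _ :: _, [] => simp at hlen
      | i :: a, j :: b =>
        obtain ⟨ha, di⟩ := isReducedExpr_cons_iff.1 hl
        obtain ⟨hb, dj⟩ := isReducedExpr_cons_iff.1 hl'
        have hwi := inv_simpleRefl_mul_of_isDescent di
        have hwj := inv_simpleRefl_mul_of_isDescent dj
        -- Adjacent first letters: both are descents, so `w` also has reduced words `i j i m` and `j
        -- i j m`. Induction compares each given tail with one of these, and the braid relation
        -- joins them.
        have step : ∀ (i j : Fin (n - 1)) (a b : List (Fin (n - 1))), (j : ℕ) = i + 1 →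
            IsReducedExpr a (simpleRefl i * w) → IsReducedExpr b (simpleRefl j * w) →
            IsDescent i w → IsDescent j w →
            t i * (a.map t).prod = t j * (b.map t).prod := by
          intro i j a b hij ha hb di dj
          have hwi := inv_simpleRefl_mul_of_isDescent di
          have hwj := inv_simpleRefl_mul_of_isDescent dj
          have hji := hi_eq_lo hij
          have e₁ : simpleRefl i (hi j) = hi j :=
            simpleRefl_of_ne (by simp [lo, hi, Fin.ext_iff]; omega)
              (by simp [hi, Fin.ext_iff]; omega)
          have e₂ : simpleRefl j (lo i) = lo i :=
            simpleRefl_of_ne (by simp [lo, Fin.ext_iff]; omega)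
              (by simp [lo, hi, Fin.ext_iff]; omega)
          have d₁ : IsDescent j (simpleRefl i * w) := by
            rw [IsDescent, inv_simpleRefl_mul_apply, inv_simpleRefl_mul_apply, e₁, ← hji,
              simpleRefl_hi]
            rw [IsDescent] at di dj
            rw [← hji] at dj
            exact dj.trans di
          have d₂ : IsDescent i (simpleRefl j * (simpleRefl i * w)) := by
            rw [IsDescent, inv_simpleRefl_mul_apply, inv_simpleRefl_mul_apply,
              inv_simpleRefl_mul_apply, inv_simpleRefl_mul_apply, hji, simpleRefl_lo, e₁, e₂,
              simpleRefl_lo, hji]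
            exact dj
          have d₁' : IsDescent i (simpleRefl j * w) := by
            rw [IsDescent, inv_simpleRefl_mul_apply, inv_simpleRefl_mul_apply, e₂, hji,
              simpleRefl_lo]
            rw [IsDescent] at di dj
            rw [hji] at di
            exact dj.trans di
          have d₂' : IsDescent j (simpleRefl i * (simpleRefl j * w)) := by
            rw [IsDescent, inv_simpleRefl_mul_apply, inv_simpleRefl_mul_apply,
              inv_simpleRefl_mul_apply, inv_simpleRefl_mul_apply, e₁, simpleRefl_hi, ← hji,
              simpleRefl_hi, e₂]
            exact di
          obtain ⟨m, hm'⟩ := exists_isReducedExpr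
            (simpleRefl i * (simpleRefl j * (simpleRefl i * w)))
          have hm'' : IsReducedExpr m (simpleRefl j * (simpleRefl i * (simpleRefl j * w))) := by
            have := congrArg (· * w) (simpleRefl_braid hij)
            simp only [mul_assoc] at this
            rwa [← this]
          rw [ih _ (by omega) a (j :: i :: m) _ rfl ha
              (isReducedExpr_cons_iff.2 ⟨isReducedExpr_cons_iff.2 ⟨hm', d₂⟩, d₁⟩),
            ih _ (by omega) b (i :: j :: m) _ rfl hb
              (isReducedExpr_cons_iff.2 ⟨isReducedExpr_cons_iff.2 ⟨hm'', d₂'⟩, d₁'⟩)]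
          have := congrArg (· * (m.map t).prod) (hbraid i j hij)
          simpa [mul_assoc] using this
        -- Distant first letters: the same argument with reduced words `i j m` and `j i m`.
        have far : (i : ℕ) + 1 < j ∨ (j : ℕ) + 1 < i →
            t i * (a.map t).prod = t j * (b.map t).prod := by
          intro hij
          obtain ⟨m, hm'⟩ := exists_isReducedExpr (simpleRefl j * (simpleRefl i * w))
          have hm'' : IsReducedExpr m (simpleRefl i * (simpleRefl j * w)) := by
            rwa [← mul_assoc, simpleRefl_comm hij, mul_assoc]
          rw [ih _ (by omega) a (j :: m) _ rfl ha
              (isReducedExpr_cons_iff.2 ⟨hm', dj.simpleRefl_mul_of_far hij⟩),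
            ih _ (by omega) b (i :: m) _ rfl hb
              (isReducedExpr_cons_iff.2 ⟨hm'', di.simpleRefl_mul_of_far hij.symm⟩)]
          simp only [List.map_cons, List.prod_cons, ← mul_assoc, hcomm i j hij]
        simp only [List.map_cons, List.prod_cons]
        rcases lt_trichotomy (i : ℕ) j with h | h | h
        · rcases Nat.lt_or_ge ((i : ℕ) + 1) j with h' | h'
          · exact far (.inl h')
          · exact step i j a b (by omega) ha hb di dj
        · obtain rfl := Fin.ext h
          rw [ih _ (by omega) a b _ rfl ha hb]
        · rcases Nat.lt_or_ge ((j : ℕ) + 1) i with h' | h'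
          · exact far (.inr h')
          · exact (step j i b a (by omega) hb ha dj di).symm
  exact main _ l l' w rfl hl hl'

end SymmetricGroup

/-! ### Induction on words -/

theorem induction_of_surjective {k X A : Type*} [Field k] [Ring A] [Algebra k A]
    (π : FreeAlgebra k X →ₐ[k] A) (hπ : Function.Surjective π) {p : A → Prop} (one : p 1)
    (add : ∀ x y, p x → p y → p (x + y)) (smul : ∀ (r : k) x, p x → p (r • x))
    (mul : ∀ j x, p x → p (π (FreeAlgebra.ι k j) * x)) (x : A) : p x := by
  obtain ⟨x, rfl⟩ := hπ x
  -- Only left multiplication by generators is controlled, so the statement is strengthened to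
  -- closure under left multiplication by all of `π x`; products then split into two steps.
  suffices h : ∀ y, p y → p (π x * y) by simpa using h 1 one
  induction x using FreeAlgebra.induction with
  | grade0 r => intro y hy; rw [AlgHom.commutes, ← Algebra.smul_def]; exact smul r y hy
  | grade1 j => exact mul j
  | mul a b ha hb => intro y hy; rw [map_mul, mul_assoc]; exact ha _ (hb _ hy)
  | add a b ha hb => intro y hy; rw [map_add, add_mul]; exact add _ _ (ha _ hy) (hb _ hy)

theorem finset_empty_symmDiff {α : Type*} [DecidableEq α] (D : Finset α) : symmDiff ∅ D = D :=
  bot_symmDiff D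

theorem finset_symmDiff_empty {α : Type*} [DecidableEq α] (D : Finset α) : symmDiff D ∅ = D :=
  symmDiff_bot D

/-! ### Anticommuting square roots of `-1` -/

section Words

variable {n : ℕ} {A : Type*} [Ring A] {c : Fin n → A}

/-- Insertion into a sorted list: `c j` anticommutes past the smaller letters, then is inserted or
cancels against an equal letter. Signs are left undetermined, since later arguments need only which
monomial occurs. -/
theorem mul_prod_eq_or_neg (hsq : ∀ j, c j * c j = -1)
    (hanti : ∀ i j, i ≠ j → c i * c j = -(c j * c i)) (j : Fin n) (L : List (Fin n))
    (hL : L.Pairwise (· < ·)) :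
    ∃ L' : List (Fin n), L'.Pairwise (· < ·) ∧ L'.toFinset = symmDiff {j} L.toFinset ∧
      (c j * (L.map c).prod = (L'.map c).prod ∨ c j * (L.map c).prod = -(L'.map c).prod) := by
  induction L with
  | nil => exact ⟨[j], by simp, by simp [finset_symmDiff_empty], by simp⟩
  | cons a L ih =>
    obtain ⟨ha, hL'⟩ := List.pairwise_cons.1 hL
    rcases lt_trichotomy j a with h | rfl | h
    · refine ⟨j :: a :: L, List.pairwise_cons.2 ⟨?_, hL⟩, ?_, .inl (by simp)⟩
      · intro b hb
        rcases List.mem_cons.1 hb with rfl | hb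
        exacts [h, h.trans (ha _ hb)]
      · ext x
        have : j ∉ L := fun hj => (h.trans (ha _ hj)).false
        simp only [List.mem_toFinset, List.mem_cons, Finset.mem_symmDiff, Finset.mem_singleton]
        grind
    · refine ⟨L, hL', ?_, .inr ?_⟩
      · ext x
        have : j ∉ L := fun hj => (ha _ hj).false
        simp only [List.mem_toFinset, List.mem_cons, Finset.mem_symmDiff, Finset.mem_singleton]
        grind
      · rw [List.map_cons, List.prod_cons, ← mul_assoc, hsq, neg_one_mul]
    · obtain ⟨L', h₁, h₂, h₃⟩ := ih hL'
      refine ⟨a :: L', List.pairwise_cons.2 ⟨?_, h₁⟩, ?_, ?_⟩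
      · intro b hb
        have : b ∈ symmDiff {j} L.toFinset := h₂ ▸ List.mem_toFinset.2 hb
        simp only [Finset.mem_symmDiff, Finset.mem_singleton, List.mem_toFinset] at this
        rcases this with ⟨rfl, -⟩ | ⟨hb, -⟩
        exacts [h, ha _ hb]
      · have : a ∉ L := fun hj => (ha _ hj).false
        rw [List.toFinset_cons, h₂]
        ext x
        simp only [List.mem_toFinset, Finset.mem_insert, List.mem_cons, Finset.mem_symmDiff,
          Finset.mem_singleton]
        grind
      · rw [List.map_cons, List.prod_cons, ← mul_assoc, hanti _ _ h.ne', neg_mul, mul_assoc]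
        rcases h₃ with h₃ | h₃
        · right; rw [h₃]; simp
        · left; rw [h₃]; simp

theorem prod_mul_eq_or_neg (hanti : ∀ i j, i ≠ j → c i * c j = -(c j * c i)) (j : Fin n)
    (L : List (Fin n)) :
    (L.map c).prod * c j = c j * (L.map c).prod ∨
      (L.map c).prod * c j = -(c j * (L.map c).prod) := by
  induction L with
  | nil => simp
  | cons a L ih =>
    have ha : c a * c j = c j * c a ∨ c a * c j = -(c j * c a) := by
      by_cases h : a = j
      · subst h; exact .inl rfl
      · exact .inr (hanti _ _ h)
    simp only [List.map_cons, List.prod_cons]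
    rw [mul_assoc, ← mul_assoc (c j)]
    rcases ih with h | h <;> rcases ha with h' | h' <;> rw [h] <;> simp [← mul_assoc, h']

/-- The product of the `c j` with `j ∈ D` in increasing order. -/
def orderedProd (c : Fin n → A) (D : Finset (Fin n)) : A := (D.sort.map c).prod

theorem mul_orderedProd (hsq : ∀ j, c j * c j = -1)
    (hanti : ∀ i j, i ≠ j → c i * c j = -(c j * c i)) (j : Fin n) (D : Finset (Fin n)) :
    c j * orderedProd c D = orderedProd c (symmDiff {j} D) ∨
      c j * orderedProd c D = -orderedProd c (symmDiff {j} D) := by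
  obtain ⟨L, h₁, h₂, h₃⟩ := mul_prod_eq_or_neg hsq hanti j D.sort (D.sortedLT_sort.pairwise)
  have : (symmDiff {j} D).sort = L := by
    rw [Finset.sort_toFinset] at h₂
    rw [← h₂]
    exact List.toFinset_sort (r := (· ≤ ·)) h₁.nodup |>.2 (h₁.imp le_of_lt)
  rwa [orderedProd, orderedProd, this]

theorem orderedProd_mul_orderedProd (hsq : ∀ j, c j * c j = -1)
    (hanti : ∀ i j, i ≠ j → c i * c j = -(c j * c i)) (D E : Finset (Fin n)) :
    orderedProd c D * orderedProd c E = orderedProd c (symmDiff D E) ∨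
      orderedProd c D * orderedProd c E = -orderedProd c (symmDiff D E) := by
  suffices h : ∀ L : List (Fin n), L.Nodup →
      (L.map c).prod * orderedProd c E = orderedProd c (symmDiff L.toFinset E) ∨
      (L.map c).prod * orderedProd c E = -orderedProd c (symmDiff L.toFinset E) by
    have := h D.sort (D.sort_nodup _)
    rwa [Finset.sort_toFinset] at this
  intro L hL
  induction L with
  | nil => simp [finset_empty_symmDiff]
  | cons a L ih =>
    obtain ⟨ha, hL⟩ := List.nodup_cons.1 hL
    have : (a :: L).toFinset = symmDiff {a} L.toFinset := by
      ext x
      simp only [List.mem_toFinset, List.mem_cons, Finset.mem_symmDiff, Finset.mem_singleton]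
      grind
    rw [this, symmDiff_assoc, List.map_cons, List.prod_cons, mul_assoc]
    rcases ih hL with h | h <;>
      rcases mul_orderedProd hsq hanti a (symmDiff L.toFinset E) with h' | h' <;>
      rw [h] <;> simp [h']

end Words

/-! ### The Clifford algebra -/

section Cliff

variable (k : Type*) [Field k] (n : ℕ)

/-- The relations of the Clifford algebra. -/
inductive CliffRel : FreeAlgebra k (Fin n) → FreeAlgebra k (Fin n) → Prop
  | sq (j : Fin n) : CliffRel (FreeAlgebra.ι k j * FreeAlgebra.ι k j) (-1)
  | anticomm (i j : Fin n) (h : i ≠ j) :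
      CliffRel (FreeAlgebra.ι k i * FreeAlgebra.ι k j) (-(FreeAlgebra.ι k j * FreeAlgebra.ι k i))

/-- The Clifford algebra on `n` anticommuting generators with square `-1`. -/
def Cliff : Type _ := RingQuot (CliffRel k n)

noncomputable instance : Ring (Cliff k n) := inferInstanceAs (Ring (RingQuot (CliffRel k n)))

noncomputable instance : Algebra k (Cliff k n) :=
  inferInstanceAs (Algebra k (RingQuot (CliffRel k n)))

/-- The quotient map from the free algebra. -/
noncomputable def Cliff.mk : FreeAlgebra k (Fin n) →ₐ[k] Cliff k n :=
  RingQuot.mkAlgHom k (CliffRel k n)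

theorem Cliff.mk_surjective : Function.Surjective (Cliff.mk k n) :=
  RingQuot.mkAlgHom_surjective k _

variable {k n} in
theorem Cliff.mk_rel {x y : FreeAlgebra k (Fin n)} (h : CliffRel k n x y) :
    Cliff.mk k n x = Cliff.mk k n y := RingQuot.mkAlgHom_rel k h

variable {n}

/-- The generators of the Clifford algebra. -/
noncomputable def e (j : Fin n) : Cliff k n :=
  Cliff.mk k n (FreeAlgebra.ι k j)

variable {k}

theorem e_sq (j : Fin n) : e k j * e k j = -1 := by
  simpa [e] using Cliff.mk_rel (CliffRel.sq (k := k) j)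

theorem e_anticomm (i j : Fin n) (h : i ≠ j) : e k i * e k j = -(e k j * e k i) := by
  simpa [e] using Cliff.mk_rel (CliffRel.anticomm (k := k) i j h)

theorem Cliff.induction {p : Cliff k n → Prop} (one : p 1)
    (add : ∀ x y, p x → p y → p (x + y)) (smul : ∀ (r : k) x, p x → p (r • x))
    (mul : ∀ j x, p x → p (e k j * x)) (x : Cliff k n) : p x :=
  induction_of_surjective (Cliff.mk k n) (Cliff.mk_surjective k n) one add smul mul x

section Lift

variable {A : Type*} [Ring A] [Algebra k A]

/-- The universal property of the Clifford algebra. -/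
noncomputable def Cliff.lift (c : Fin n → A) (hsq : ∀ j, c j * c j = -1)
    (hanti : ∀ i j, i ≠ j → c i * c j = -(c j * c i)) : Cliff k n →ₐ[k] A :=
  RingQuot.liftAlgHom k ⟨FreeAlgebra.lift k c, fun x y h => by
    cases h with
    | sq j => simpa using hsq j
    | anticomm i j h => simpa using hanti i j h⟩

@[simp] theorem Cliff.lift_e (c : Fin n → A) (hsq : ∀ j, c j * c j = -1)
    (hanti : ∀ i j, i ≠ j → c i * c j = -(c j * c i)) (j : Fin n) :
    Cliff.lift c hsq hanti (e k j) = c j := by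
  exact (RingQuot.liftAlgHom_mkAlgHom_apply k _ _ _).trans (FreeAlgebra.lift_ι_apply _ _)

end Lift

/-- The automorphism permuting the generators. -/
noncomputable def permHom (s : Equiv.Perm (Fin n)) : Cliff k n →ₐ[k] Cliff k n :=
  Cliff.lift (fun j => e k (s j)) (fun _ => e_sq _)
    (fun _ _ h => e_anticomm _ _ (s.injective.ne h))

@[simp] theorem permHom_e (s : Equiv.Perm (Fin n)) (j : Fin n) :
    permHom s (e k j) = e k (s j) := Cliff.lift_e _ _ _ _

theorem span_orderedProd :
    Submodule.span k (Set.range (orderedProd (e k (n := n)))) = ⊤ := by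
  refine Submodule.eq_top_iff'.2 fun x => ?_
  induction x using Cliff.induction with
  | one => exact Submodule.subset_span ⟨∅, by simp [orderedProd]⟩
  | add x y hx hy => exact add_mem hx hy
  | smul r x hx => exact Submodule.smul_mem _ _ hx
  | mul j x hx =>
    induction hx using Submodule.span_induction with
    | mem x h =>
      obtain ⟨D, rfl⟩ := h
      rcases mul_orderedProd (e_sq (k := k)) e_anticomm j D with h | h <;> rw [h]
      · exact Submodule.subset_span ⟨_, rfl⟩
      · exact neg_mem (Submodule.subset_span ⟨_, rfl⟩)
    | zero => simp
    | add x y _ _ hx hy => rw [mul_add]; exact add_mem hx hy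
    | smul r x _ hx => rw [mul_smul_comm]; exact Submodule.smul_mem _ _ hx

instance : FiniteDimensional k (Cliff k n) :=
  ⟨⟨(Set.finite_range (orderedProd (e k (n := n)))).toFinset, by simp [span_orderedProd]⟩⟩

/-- `-1` if `i ∈ D`, and `1` otherwise. -/
def memSign (k : Type*) [Field k] (D : Finset (Fin n)) (i : Fin n) : k := if i ∈ D then -1 else 1

theorem memSign_symmDiff (D : Finset (Fin n)) (i j : Fin n) :
    memSign k (symmDiff {j} D) i = memSign k D i * if i = j then -1 else 1 := by
  simp only [memSign, Finset.mem_symmDiff, Finset.mem_singleton]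
  split_ifs <;> simp_all

/-- The sign with which the generator `j` contributes to the coefficient at `D`. -/
def toggleSign (k : Type*) [Field k] (j : Fin n) (D : Finset (Fin n)) : k :=
  -((∏ i ∈ Finset.Iio j, memSign k D i) * memSign k D j)

/-- The sign flips exactly when `i ≤ j`. Equality gives square `-1`; for `i ≠ j` exactly one of the
two orders flips, which gives anticommutation. -/
theorem toggleSign_symmDiff (i j : Fin n) (D : Finset (Fin n)) :
    toggleSign k j (symmDiff {i} D) = toggleSign k j D * if i ≤ j then -1 else 1 := by
  simp only [toggleSign, memSign_symmDiff, Finset.prod_mul_distrib, Finset.prod_ite_eq',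
    Finset.mem_Iio]
  rcases lt_trichotomy i j with h | rfl | h
  · simp [h, h.le, h.ne']
  · simp
  · simp [h.not_gt, h.not_ge, h.ne]

theorem toggleSign_eq (j : Fin n) (D : Finset (Fin n)) :
    toggleSign k j D = 1 ∨ toggleSign k j D = -1 := by
  have h : ∀ s : Finset (Fin n), ∏ i ∈ s, memSign k D i = 1 ∨ ∏ i ∈ s, memSign k D i = -1 := by
    intro s
    induction s using Finset.induction with
    | empty => simp
    | insert a s ha ih =>
      rw [Finset.prod_insert ha, memSign]
      split_ifs <;> rcases ih with h | h <;> simp [h]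
  rw [toggleSign, memSign]
  split_ifs <;> rcases h (Finset.Iio j) with h | h <;> simp [h]

/-- The action of a generator on functions of subsets. -/
def toggle (j : Fin n) : Module.End k (Finset (Fin n) → k) where
  toFun f D := toggleSign k j D * f (symmDiff {j} D)
  map_add' f g := by ext; simp [mul_add]
  map_smul' r f := by ext; simp [mul_left_comm]

theorem toggle_apply (j : Fin n) (f : Finset (Fin n) → k) (D : Finset (Fin n)) :
    toggle j f D = toggleSign k j D * f (symmDiff {j} D) := rfl

/-- The action of the Clifford algebra on functions of subsets. -/
noncomputable def toggleRep : Cliff k n →ₐ[k] Module.End k (Finset (Fin n) → k) :=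
  Cliff.lift toggle
    (fun j => by
      refine LinearMap.ext fun f => funext fun D => ?_
      simp only [Module.End.mul_apply, toggle_apply, toggleSign_symmDiff, LinearMap.neg_apply,
        Module.End.one_apply, Pi.neg_apply, symmDiff_symmDiff_cancel_left]
      rcases toggleSign_eq (k := k) j D with h | h <;> simp [h])
    (fun i j h => by
      refine LinearMap.ext fun f => funext fun D => ?_
      simp only [Module.End.mul_apply, toggle_apply, toggleSign_symmDiff, LinearMap.neg_apply,
        Pi.neg_apply, symmDiff_left_comm {j} {i} D]
      rcases lt_or_gt_of_ne h with h | h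
      · simp [h.le, h.not_ge]; ring
      · simp [h.le, h.not_ge]; ring)

/-- The coefficient of `1`. -/
noncomputable def coeffOne : Cliff k n →ₗ[k] k :=
  LinearMap.proj ∅ ∘ₗ (LinearMap.applyₗ (Pi.single ∅ 1)) ∘ₗ toggleRep.toLinearMap

theorem coeffOne_apply (x : Cliff k n) : coeffOne x = toggleRep x (Pi.single ∅ 1) ∅ := rfl

@[simp] theorem coeffOne_one : coeffOne (1 : Cliff k n) = 1 := by
  simp [coeffOne_apply]

/-- A product of generators sends `f` to a function whose value at `D` is a multiple of `f` at a
translate of `D`. For distinct generators and a nonempty list, the translate of `∅` is nonempty,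
where the starting delta function vanishes. -/
theorem coeffOne_prod {L : List (Fin n)} (hL : L.Nodup) (hne : L ≠ []) :
    coeffOne (L.map (e k)).prod = 0 := by
  have key : ∀ (L : List (Fin n)), L.Nodup → ∀ (f : Finset (Fin n) → k) (D : Finset (Fin n)),
      f (symmDiff L.toFinset D) = 0 → toggleRep (L.map (e k)).prod f D = 0 := by
    intro L hL
    induction L with
    | nil => simp [finset_empty_symmDiff]
    | cons a L ih =>
      obtain ⟨ha, hL⟩ := List.nodup_cons.1 hL
      intro f D hf
      have : (a :: L).toFinset = symmDiff {a} L.toFinset := by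
        ext x
        simp only [List.mem_toFinset, List.mem_cons, Finset.mem_symmDiff, Finset.mem_singleton]
        grind
      rw [List.map_cons, List.prod_cons, map_mul, Module.End.mul_apply]
      rw [show toggleRep (e k a) = toggle a from Cliff.lift_e _ _ _ _, toggle_apply, ih hL,
        mul_zero]
      rwa [symmDiff_left_comm, ← symmDiff_assoc, ← this]
  refine key L hL _ _ (Pi.single_eq_of_ne ?_ _)
  obtain ⟨a, L, rfl⟩ := List.exists_cons_of_ne_nil hne
  exact Finset.nonempty_iff_ne_empty.1 ⟨a, by simp [finset_symmDiff_empty]⟩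

theorem coeffOne_orderedProd (D : Finset (Fin n)) :
    coeffOne (orderedProd (e k) D) = if D = ∅ then 1 else 0 := by
  split_ifs with h
  · simp [h, orderedProd]
  · refine coeffOne_prod (D.sort_nodup _) fun h' => h ?_
    rw [← Finset.sort_toFinset (r := (· ≤ ·)) D, h']; rfl

/-! ### The bilinear form given by the constant term of a product. -/

theorem linearMap_ext_orderedProd {M : Type*} [AddCommGroup M] [Module k M]
    {f g : Cliff k n →ₗ[k] M} (h : ∀ D, f (orderedProd (e k) D) = g (orderedProd (e k) D)) :
    f = g :=
  LinearMap.ext_on span_orderedProd (by rintro _ ⟨D, rfl⟩; exact h D)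

theorem coeffOne_permHom (s : Equiv.Perm (Fin n)) (x : Cliff k n) :
    coeffOne (permHom s x) = coeffOne x := by
  suffices h : coeffOne ∘ₗ (permHom s).toLinearMap = coeffOne (k := k) from
    LinearMap.congr_fun h x
  refine linearMap_ext_orderedProd fun D => ?_
  by_cases h : D.sort = []
  · simp [orderedProd, h]
  · have : permHom s (orderedProd (e k) D) = ((D.sort.map s).map (e k)).prod := by
      simp [orderedProd, map_list_prod, Function.comp_def]
    simp only [LinearMap.comp_apply, AlgHom.toLinearMap_apply, this]
    rw [coeffOne_prod ((D.sort_nodup _).map s.injective) (by simpa using h), orderedProd,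
      coeffOne_prod (D.sort_nodup _) h]

/-- The form is symmetric without super signs. On `e_j` and a monomial both sides vanish unless the
monomial is `e_j` itself, so the sign from reordering is invisible. -/
theorem coeffOne_mul_comm (x y : Cliff k n) : coeffOne (x * y) = coeffOne (y * x) := by
  have gen : ∀ (j : Fin n) (y : Cliff k n), coeffOne (e k j * y) = coeffOne (y * e k j) := by
    intro j y
    suffices h : coeffOne ∘ₗ LinearMap.mulLeft k (e k j) =
        coeffOne ∘ₗ LinearMap.mulRight k (e k j) from LinearMap.congr_fun h y
    refine linearMap_ext_orderedProd fun D => ?_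
    simp only [LinearMap.comp_apply, LinearMap.mulLeft_apply, LinearMap.mulRight_apply]
    by_cases h : D = {j}
    · simp [h, orderedProd]
    · have h₀ : coeffOne (e k j * orderedProd (e k) D) = 0 := by
        have : coeffOne (orderedProd (e k) (symmDiff {j} D)) = 0 := by
          rw [coeffOne_orderedProd, if_neg]
          rw [← Finset.bot_eq_empty, symmDiff_eq_bot]
          exact fun h' => h h'.symm
        rcases mul_orderedProd (e_sq (k := k)) e_anticomm j D with h | h <;> rw [h]
        · exact this
        · rw [map_neg, this, neg_zero]
      rcases prod_mul_eq_or_neg (e_anticomm (k := k)) j D.sort with h | h <;>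
        rw [orderedProd] at h₀ ⊢ <;> rw [h]
      rw [map_neg, h₀, neg_zero]
  induction x using Cliff.induction generalizing y with
  | one => simp
  | add x z hx hz => simp [add_mul, mul_add, hx, hz]
  | smul r x hx => simp [hx]
  | mul j x hx => rw [mul_assoc, gen, mul_assoc, hx, mul_assoc]

/-- A product of two ordered monomials has constant term `±1` if they agree and `0` otherwise.
Testing against each monomial therefore isolates its coefficient. -/
theorem eq_zero_of_coeffOne {x : Cliff k n} (h : ∀ y, coeffOne (y * x) = 0) : x = 0 := by
  have hx : x ∈ Submodule.span k (Set.range (orderedProd (e k (n := n)))) := by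
    rw [span_orderedProd]; trivial
  obtain ⟨a, rfl⟩ := (Submodule.mem_span_range_iff_exists_fun k).1 hx
  refine Finset.sum_eq_zero fun D _ => ?_
  have hD := h (orderedProd (e k) D)
  have hc : ∀ E, coeffOne (orderedProd (e k) D * orderedProd (e k) E) = 0 ∨ E = D := by
    intro E
    by_cases hE : E = D
    · exact .inr hE
    · left
      have : coeffOne (orderedProd (e k) (symmDiff D E)) = 0 := by
        rw [coeffOne_orderedProd, if_neg]
        rw [← Finset.bot_eq_empty, symmDiff_eq_bot]
        exact fun h' => hE h'.symm
      rcases orderedProd_mul_orderedProd (e_sq (k := k)) e_anticomm D E with h | h <;> rw [h]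
      · exact this
      · rw [map_neg, this, neg_zero]
  rw [Finset.mul_sum, map_sum, Finset.sum_eq_single D] at hD
  · have : coeffOne (orderedProd (e k) D * orderedProd (e k) D) ≠ 0 := by
      have h1 : coeffOne (orderedProd (e k) (symmDiff D D)) = 1 := by
        rw [symmDiff_self, Finset.bot_eq_empty, coeffOne_orderedProd, if_pos rfl]
      rcases orderedProd_mul_orderedProd (e_sq (k := k)) e_anticomm D D with h | h <;> rw [h]
      · rw [h1]; exact one_ne_zero
      · rw [map_neg, h1]; exact neg_ne_zero.2 one_ne_zero
    rw [mul_smul_comm, map_smul, smul_eq_mul] at hD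
    rw [(mul_eq_zero.1 hD).resolve_right this, zero_smul]
  · intro E _ hE
    rw [mul_smul_comm, map_smul, (hc E).resolve_right hE, smul_zero]
  · simp

end Cliff

/-! ### Families satisfying the defining relations -/

section Relations

variable {n : ℕ} {A : Type*} [Ring A]

/-- The mixed relations between the `t i` and the `c j`. -/
structure MixedRelations (t : Fin (n - 1) → A) (c : Fin n → A) : Prop where
  far : ∀ (i : Fin (n - 1)) (j : Fin n), j ≠ lo i → j ≠ hi i → t i * c j = c j * t i
  lo : ∀ i, t i * c (lo i) = c (hi i) * t i
  -- The defining relation solved for `t i * c (hi i)`, so that all three fields are rules moving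
  -- `t` to the right of `c`.
  hi : ∀ i, t i * c (hi i) = c (HeckeClifford.lo i) * t i + c (HeckeClifford.lo i) - c (hi i)

/-- All defining relations of the 0-Hecke-Clifford algebra. -/
structure HCRelations (t : Fin (n - 1) → A) (c : Fin n → A) : Prop
    extends MixedRelations t c where
  T_sq : ∀ i, t i * t i = -t i
  T_comm : ∀ i j : Fin (n - 1), (i : ℕ) + 1 < j ∨ (j : ℕ) + 1 < i → t i * t j = t j * t i
  T_braid : ∀ i j : Fin (n - 1), (j : ℕ) = i + 1 → t i * t j * t i = t j * t i * t j
  c_sq : ∀ j, c j * c j = -1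
  c_anticomm : ∀ i j, i ≠ j → c i * c j = -(c j * c i)

/-- Lets a rewriting rule for `a * b` act inside right-nested products. -/
theorem mul_mul_of_mul_eq {a b d : A} (h : a * b = d) (x : A) : a * (b * x) = d * x := by
  rw [← mul_assoc, h]

/-- This and the next two lemmas use the mixed relations to move the defect of a `T` relation past
`c p`. They serve to prove those relations in the regular representation, where they are not yet
known. -/
theorem MixedRelations.sq_add_mul {t : Fin (n - 1) → A} {c : Fin n → A} (h : MixedRelations t c)
    (i : Fin (n - 1)) (p : Fin n) : (t i * t i + t i) * c p = c p * (t i * t i + t i) := by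
  by_cases h₁ : p = HeckeClifford.lo i
  · subst h₁
    simp only [add_mul, mul_add, mul_assoc, h.lo, mul_mul_of_mul_eq (h.hi i), sub_mul]
    abel
  by_cases h₂ : p = HeckeClifford.hi i
  · subst h₂
    simp only [add_mul, mul_add, mul_sub, mul_assoc, h.hi, mul_mul_of_mul_eq (h.lo i), h.lo]
    abel
  simp only [add_mul, mul_add, mul_assoc, h.far i p h₁ h₂, mul_mul_of_mul_eq (h.far i p h₁ h₂)]

theorem MixedRelations.comm_sub_mul {t : Fin (n - 1) → A} {c : Fin n → A}
    (h : MixedRelations t c) {i j : Fin (n - 1)} (hij : (i : ℕ) + 1 < j ∨ (j : ℕ) + 1 < i)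
    (p : Fin n) : ∃ q, (t i * t j - t j * t i) * c p = c q * (t i * t j - t j * t i) := by
  have key : ∀ i j : Fin (n - 1), ((i : ℕ) + 1 < j ∨ (j : ℕ) + 1 < i) →
      p = HeckeClifford.lo i ∨ p = HeckeClifford.hi i →
      ∃ q, (t i * t j - t j * t i) * c p = c q * (t i * t j - t j * t i) := by
    intro i j hij hp
    have f₁ := h.far j (HeckeClifford.lo i)
      (by simp only [HeckeClifford.lo, ne_eq, Fin.ext_iff]; omega)
      (by simp only [HeckeClifford.lo, HeckeClifford.hi, ne_eq, Fin.ext_iff]; omega)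
    have f₂ := h.far j (HeckeClifford.hi i)
      (by simp only [HeckeClifford.lo, HeckeClifford.hi, ne_eq, Fin.ext_iff]; omega)
      (by simp only [HeckeClifford.hi, ne_eq, Fin.ext_iff]; omega)
    rcases hp with rfl | rfl
    · refine ⟨HeckeClifford.hi i, ?_⟩
      simp only [sub_mul, mul_sub, mul_assoc, f₁, h.lo, mul_mul_of_mul_eq (h.lo i),
        mul_mul_of_mul_eq f₂]
    · refine ⟨HeckeClifford.lo i, ?_⟩
      simp only [sub_mul, add_mul, mul_add, mul_sub, mul_assoc, f₂, f₁, h.hi,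
        mul_mul_of_mul_eq (h.hi i), mul_mul_of_mul_eq f₁]
      abel
  by_cases h₁ : p = HeckeClifford.lo i ∨ p = HeckeClifford.hi i
  · exact key i j hij h₁
  by_cases h₂ : p = HeckeClifford.lo j ∨ p = HeckeClifford.hi j
  · obtain ⟨q, hq⟩ := key j i hij.symm h₂
    refine ⟨q, ?_⟩
    rw [← neg_sub (t j * t i), neg_mul, hq, mul_neg]
  rw [not_or] at h₁ h₂
  have f₁ := h.far i p h₁.1 h₁.2
  have f₂ := h.far j p h₂.1 h₂.2
  refine ⟨p, ?_⟩
  simp only [sub_mul, mul_sub, mul_assoc, f₁, f₂, mul_mul_of_mul_eq f₁, mul_mul_of_mul_eq f₂]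

theorem MixedRelations.braid_sub_mul {t : Fin (n - 1) → A} {c : Fin n → A}
    (h : MixedRelations t c) (hsq : ∀ i, t i * t i = -t i) {i j : Fin (n - 1)}
    (hij : (j : ℕ) = i + 1) (p : Fin n) :
    -- In each case `q` is the image of `p` under `s_i s_j s_i`. Moving past `c (hi j)` produces
    -- squares of `t`, which is where `hsq` enters.
    ∃ q, (t i * t j * t i - t j * t i * t j) * c p =
      c q * (t i * t j * t i - t j * t i * t j) := by
  have e₀ := hi_eq_lo hij
  have a₁ := h.lo i
  have a₂ := h.hi i
  have b₂ := h.lo j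
  have b₃ := h.hi j
  have a₃ := h.far i (HeckeClifford.hi j)
    (by simp only [HeckeClifford.lo, HeckeClifford.hi, ne_eq, Fin.ext_iff]; omega)
    (by simp only [HeckeClifford.hi, ne_eq, Fin.ext_iff]; omega)
  have b₁ := h.far j (HeckeClifford.lo i)
    (by simp only [HeckeClifford.lo, ne_eq, Fin.ext_iff]; omega)
    (by simp only [HeckeClifford.lo, HeckeClifford.hi, ne_eq, Fin.ext_iff]; omega)
  rw [e₀] at a₁ a₂
  by_cases h₁ : p = HeckeClifford.lo i
  · subst h₁
    refine ⟨HeckeClifford.hi j, ?_⟩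
    simp only [sub_mul, mul_sub, mul_assoc, a₁, b₁, mul_mul_of_mul_eq a₁, mul_mul_of_mul_eq a₃,
      mul_mul_of_mul_eq b₂]
  by_cases h₂ : p = HeckeClifford.lo j
  · subst h₂
    refine ⟨HeckeClifford.lo j, ?_⟩
    simp only [sub_mul, mul_sub, add_mul, mul_add, mul_assoc, a₂, b₂, b₁,
      mul_mul_of_mul_eq a₁, mul_mul_of_mul_eq a₃, mul_mul_of_mul_eq b₁,
      mul_mul_of_mul_eq b₃]
    abel
  by_cases h₃ : p = HeckeClifford.hi j
  · subst h₃
    refine ⟨HeckeClifford.lo i, ?_⟩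
    simp only [sub_mul, mul_sub, add_mul, mul_add, mul_assoc, a₂, b₂, b₁, a₃, b₃,
      mul_mul_of_mul_eq a₃, mul_mul_of_mul_eq b₁, mul_mul_of_mul_eq a₂,
      mul_mul_of_mul_eq b₂, mul_mul_of_mul_eq b₃,
      hsq, mul_neg]
    abel
  have f₁ := h.far i p h₁ (by rwa [e₀])
  have f₂ := h.far j p h₂ h₃
  refine ⟨p, ?_⟩
  simp only [sub_mul, mul_sub, mul_assoc, f₁, f₂, mul_mul_of_mul_eq f₁, mul_mul_of_mul_eq f₂]

/-! ### Sign change and order reversal as symmetries of the relations. -/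

theorem HCRelations.neg {t : Fin (n - 1) → A} {c : Fin n → A} (h : HCRelations t c) :
    HCRelations t (fun j => -c j) where
  far i j h₁ h₂ := by simp [h.far i j h₁ h₂]
  lo i := by simp [h.lo]
  hi i := by simp [h.hi]; abel
  T_sq := h.T_sq
  T_comm := h.T_comm
  T_braid := h.T_braid
  c_sq j := by simp [h.c_sq]
  c_anticomm i j hij := by simp [h.c_anticomm i j hij]

theorem lo_rev (i : Fin (n - 1)) : HeckeClifford.lo i.rev = (HeckeClifford.hi i).rev := by
  simp only [HeckeClifford.lo, HeckeClifford.hi, Fin.ext_iff, Fin.val_rev]; omega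

theorem hi_rev (i : Fin (n - 1)) : HeckeClifford.hi i.rev = (HeckeClifford.lo i).rev := by
  simp only [HeckeClifford.lo, HeckeClifford.hi, Fin.ext_iff, Fin.val_rev]; omega

/-- Both sides are normalised by moving every `c` to the left and sorting; the pure `t` terms agree
by the braid relation and the rest cancels. When `2` is invertible, the twist amounts to reversing
the indices of `t i + (1 + c (lo i) * c (hi i)) / 2`. -/
theorem HCRelations.twist_braid {t : Fin (n - 1) → A} {c : Fin n → A} (h : HCRelations t c)
    {i j : Fin (n - 1)} (hij : (j : ℕ) = i + 1) :
    (t i + c (HeckeClifford.lo i) * c (HeckeClifford.hi i)) *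
        (t j + c (HeckeClifford.lo j) * c (HeckeClifford.hi j)) *
        (t i + c (HeckeClifford.lo i) * c (HeckeClifford.hi i)) =
      (t j + c (HeckeClifford.lo j) * c (HeckeClifford.hi j)) *
        (t i + c (HeckeClifford.lo i) * c (HeckeClifford.hi i)) *
        (t j + c (HeckeClifford.lo j) * c (HeckeClifford.hi j)) := by
  have e₀ := hi_eq_lo hij
  have a₁ := h.lo i
  have a₂ := h.hi i
  have b₂ := h.lo j
  have b₃ := h.hi j
  have n₁₃ : HeckeClifford.hi j ≠ HeckeClifford.lo i := by
    simp only [HeckeClifford.lo, HeckeClifford.hi, ne_eq, Fin.ext_iff]; omega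
  have n₁₂ : HeckeClifford.lo j ≠ HeckeClifford.lo i := by
    simp only [HeckeClifford.lo, ne_eq, Fin.ext_iff]; omega
  have a₃ := h.far i (HeckeClifford.hi j) n₁₃ (by rw [e₀]; exact (lo_ne_hi j).symm)
  have b₁ := h.far j (HeckeClifford.lo i) n₁₂.symm n₁₃.symm
  have c₂₁ := h.c_anticomm _ _ n₁₂
  have c₃₁ := h.c_anticomm _ _ n₁₃
  have c₃₂ := h.c_anticomm _ _ (lo_ne_hi j).symm
  have br := h.T_braid i j hij
  rw [mul_assoc, mul_assoc] at br
  rw [e₀] at a₁ a₂ ⊢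
  simp only [mul_neg, neg_mul, add_mul, mul_add, sub_mul, mul_sub, mul_assoc, a₂, a₃, b₂,
    b₃, c₂₁, c₃₂, h.c_sq, h.T_sq, mul_mul_of_mul_eq a₁, mul_mul_of_mul_eq a₂,
    mul_mul_of_mul_eq a₃, mul_mul_of_mul_eq b₁, mul_mul_of_mul_eq b₂, mul_mul_of_mul_eq b₃,
    mul_mul_of_mul_eq c₂₁, mul_mul_of_mul_eq c₃₁, mul_mul_of_mul_eq c₃₂,
    mul_mul_of_mul_eq (h.c_sq _), mul_one, one_mul, br, neg_neg]
  abel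

/-- The relations are preserved by the order-reversing twist. -/
theorem HCRelations.twist {t : Fin (n - 1) → A} {c : Fin n → A} (h : HCRelations t c) :
    HCRelations (fun i => t i.rev + c (HeckeClifford.lo i.rev) * c (HeckeClifford.hi i.rev))
      (fun j => -c j.rev) where
  far i j h₁ h₂ := by
    have n₁ : j.rev ≠ HeckeClifford.lo i.rev := by rw [lo_rev]; simpa using h₂
    have n₂ : j.rev ≠ HeckeClifford.hi i.rev := by rw [hi_rev]; simpa using h₁
    simp only [mul_neg, neg_mul, add_mul, mul_add, h.far _ _ n₁ n₂, mul_assoc, neg_add,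
      h.c_anticomm _ _ n₂, mul_mul_of_mul_eq (h.c_anticomm _ _ n₁), neg_neg]
  lo i := by
    rw [← hi_rev, ← lo_rev]
    simp only [mul_neg, neg_mul, add_mul, mul_add, mul_assoc, h.hi, h.c_sq,
      mul_mul_of_mul_eq (h.c_sq _), mul_one, one_mul]
    abel
  hi i := by
    rw [← hi_rev, ← lo_rev]
    have a := h.c_anticomm _ _ (lo_ne_hi i.rev).symm
    simp only [mul_neg, neg_mul, add_mul, mul_add, mul_assoc, h.lo, h.c_sq, a,
      mul_mul_of_mul_eq (h.c_sq _), mul_mul_of_mul_eq a, mul_one, one_mul]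
    abel
  T_sq i := by
    have a := h.c_anticomm _ _ (lo_ne_hi i.rev).symm
    simp only [mul_neg, neg_mul, add_mul, mul_add, mul_sub, mul_assoc, h.hi,
      h.c_sq, a, mul_mul_of_mul_eq (h.lo _), h.T_sq,
      mul_mul_of_mul_eq a, mul_one]
    abel
  T_comm i j hij := by
    have hij' : (i.rev : ℕ) + 1 < j.rev ∨ (j.rev : ℕ) + 1 < i.rev := by
      simp only [Fin.val_rev]; omega
    have far : ∀ i j : Fin (n - 1), ((i : ℕ) + 1 < j ∨ (j : ℕ) + 1 < i) →
        Commute (t i) (c (HeckeClifford.lo j) * c (HeckeClifford.hi j)) := fun i j hij =>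
      .mul_right
        (h.far _ _ (by simp only [HeckeClifford.lo, ne_eq, Fin.ext_iff]; omega)
          (by simp only [HeckeClifford.lo, HeckeClifford.hi, ne_eq, Fin.ext_iff]; omega))
        (h.far _ _ (by simp only [HeckeClifford.lo, HeckeClifford.hi, ne_eq, Fin.ext_iff]; omega)
          (by simp only [HeckeClifford.hi, ne_eq, Fin.ext_iff]; omega))
    have a₁ := h.c_anticomm (HeckeClifford.lo j.rev) (HeckeClifford.lo i.rev)
      (by simp only [HeckeClifford.lo, ne_eq, Fin.ext_iff]; omega)
    have a₂ := h.c_anticomm (HeckeClifford.lo j.rev) (HeckeClifford.hi i.rev)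
      (by simp only [HeckeClifford.lo, HeckeClifford.hi, ne_eq, Fin.ext_iff]; omega)
    have a₃ := h.c_anticomm (HeckeClifford.hi j.rev) (HeckeClifford.lo i.rev)
      (by simp only [HeckeClifford.lo, HeckeClifford.hi, ne_eq, Fin.ext_iff]; omega)
    have a₄ := h.c_anticomm (HeckeClifford.hi j.rev) (HeckeClifford.hi i.rev)
      (by simp only [HeckeClifford.hi, ne_eq, Fin.ext_iff]; omega)
    have cc : Commute (c (HeckeClifford.lo i.rev) * c (HeckeClifford.hi i.rev))
        (c (HeckeClifford.lo j.rev) * c (HeckeClifford.hi j.rev)) := by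
      simp only [Commute, SemiconjBy, mul_assoc, a₄, mul_mul_of_mul_eq a₁,
        mul_mul_of_mul_eq a₂, mul_mul_of_mul_eq a₃, neg_mul, mul_neg, neg_neg]
    exact (Commute.add_left (.add_right (h.T_comm _ _ hij') (far _ _ hij'))
      (.add_right (far _ _ hij'.symm).symm cc)).eq
  T_braid i j hij := by
    -- Reversal exchanges the roles of the two neighbours, hence the symmetric form of the identity
    -- below.
    have hij' : (i.rev : ℕ) = j.rev + 1 := by simp only [Fin.val_rev]; omega
    have := h.twist_braid hij'
    exact this.symm
  c_sq j := by simp [h.c_sq]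
  c_anticomm i j hij := by
    simp [h.c_anticomm i.rev j.rev (by simpa using hij)]

end Relations

/-! ### The universal property of the 0-Hecke-Clifford algebra -/

section Universal

variable {k : Type*} [Field k] {n : ℕ}

theorem hcRelations : HCRelations (T k (n := n)) (c k) where
  far i j h₁ h₂ := by
    simpa [T, c, gen] using RingQuot.mkAlgHom_rel k (Rel.T_c_far (k := k) i j h₁ h₂)
  lo i := by simpa [T, c, gen] using RingQuot.mkAlgHom_rel k (Rel.T_c_lo (k := k) i)
  hi i := by
    have h : (T k i + 1) * c k (hi i) = c k (lo i) * (T k i + 1) := by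
      simpa only [T, c, gen, map_mul, map_add, map_one] using
        RingQuot.mkAlgHom_rel k (Rel.T_c_hi (k := k) i)
    rw [add_mul, mul_add, one_mul, mul_one] at h
    rw [← h, add_sub_cancel_right]
  T_sq i := by simpa [T, gen] using RingQuot.mkAlgHom_rel k (Rel.T_sq (k := k) i)
  T_comm i j h := by simpa [T, gen] using RingQuot.mkAlgHom_rel k (Rel.T_comm (k := k) i j h)
  T_braid i j h := by simpa [T, gen] using RingQuot.mkAlgHom_rel k (Rel.T_braid (k := k) i j h)
  c_sq j := by simpa [c, gen] using RingQuot.mkAlgHom_rel k (Rel.c_sq (k := k) j)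
  c_anticomm i j h := by
    simpa [c, gen] using RingQuot.mkAlgHom_rel k (Rel.c_anticomm (k := k) i j h)

theorem HC.neg_mul (a b : HC k n) : -a * b = -(a * b) := _root_.neg_mul a b

theorem HC.mul_neg (a b : HC k n) : a * -b = -(a * b) := _root_.mul_neg a b

theorem HC.neg_mul_neg (a b : HC k n) : -a * -b = a * b := _root_.neg_mul_neg a b

theorem HC.neg_eq_smul (a : HC k n) : -a = (-1 : k) • a := (neg_one_smul k a).symm

variable {A : Type*} [Ring A] [Algebra k A]

/-- The values on the generators. -/
def genCases (t : Fin (n - 1) → A) (d : Fin n → A) : Gen n → A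
  | .T i => t i
  | .c j => d j

/-- The algebra homomorphism determined by a family satisfying the relations. -/
noncomputable def HC.lift {t : Fin (n - 1) → A} {d : Fin n → A} (h : HCRelations t d) :
    HC k n →ₐ[k] A :=
  RingQuot.liftAlgHom k ⟨FreeAlgebra.lift k (genCases t d), fun x y r => by
    cases r with
    | T_sq i => simpa [genCases] using h.T_sq i
    | T_comm i j hij => simpa [genCases] using h.T_comm i j hij
    | T_braid i j hij => simpa [genCases] using h.T_braid i j hij
    | c_sq j => simpa [genCases] using h.c_sq j
    | c_anticomm i j hij => simpa [genCases] using h.c_anticomm i j hij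
    | T_c_far i j h₁ h₂ => simpa [genCases] using h.far i j h₁ h₂
    | T_c_lo i => simpa [genCases] using h.lo i
    | T_c_hi i =>
      simp only [map_mul, map_add, FreeAlgebra.lift_ι_apply, genCases, add_mul, mul_add,
        one_mul, mul_one, h.hi]
      abel⟩

@[simp] theorem HC.lift_T {t : Fin (n - 1) → A} {d : Fin n → A} (h : HCRelations t d)
    (i : Fin (n - 1)) : HC.lift (k := k) h (T k i) = t i := by
  simp [HC.lift, T, gen, genCases]

@[simp] theorem HC.lift_c {t : Fin (n - 1) → A} {d : Fin n → A} (h : HCRelations t d)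
    (j : Fin n) : HC.lift (k := k) h (c k j) = d j := by
  simp [HC.lift, c, gen, genCases]

theorem HC.induction {p : HC k n → Prop} (one : p 1)
    (add : ∀ x y, p x → p y → p (x + y)) (smul : ∀ (r : k) x, p x → p (r • x))
    (T_mul : ∀ i x, p x → p (T k i * x)) (c_mul : ∀ j x, p x → p (c k j * x)) (x : HC k n) :
    p x :=
  induction_of_surjective (RingQuot.mkAlgHom k (Rel k n))
    (RingQuot.mkAlgHom_surjective k _) one add smul
    (fun g => match g with
      | .T i => T_mul i
      | .c j => c_mul j) x

/-- The Clifford algebra mapped to the 0-Hecke-Clifford algebra. -/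
noncomputable def cliffHom : Cliff k n →ₐ[k] HC k n :=
  Cliff.lift (c k) hcRelations.c_sq hcRelations.c_anticomm

@[simp] theorem cliffHom_e (j : Fin n) : cliffHom (e k j) = c k j := Cliff.lift_e _ _ _ _

theorem cliffHom_orderedProd (D : Finset (Fin n)) : cliffHom (orderedProd (e k) D) = cProd k D := by
  simp [orderedProd, cProd, map_list_prod, Function.comp_def]

end Universal

/-! ### Twisted derivations of the Clifford algebra -/

section Derivation

variable {k : Type*} [Field k] {n : ℕ}

/-- The automorphism of the Clifford algebra exchanging two adjacent generators. -/
noncomputable abbrev refl (i : Fin (n - 1)) : Cliff k n →ₐ[k] Cliff k n := permHom (simpleRefl i)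

/-- The element `(1 + e_i e_{i+1}) / 2`. -/
noncomputable def halfUnit (k : Type*) [Field k] (i : Fin (n - 1)) : Cliff k n :=
  (2⁻¹ : k) • (1 + e k (lo i) * e k (hi i))

/-- The twisted derivation `x ↦ s_i(x) u - u x` that measures the failure of `T_i` to commute with
the Clifford algebra. -/
noncomputable def der (i : Fin (n - 1)) : Cliff k n →ₗ[k] Cliff k n :=
  LinearMap.mulRight k (halfUnit k i) ∘ₗ (refl i).toLinearMap -
    LinearMap.mulLeft k (halfUnit k i)

theorem der_apply (i : Fin (n - 1)) (x : Cliff k n) :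
    der i x = refl i x * halfUnit k i - halfUnit k i * x := rfl

@[simp] theorem der_one (i : Fin (n - 1)) : der i (1 : Cliff k n) = 0 := by simp [der_apply]

/-- Automatic for an inner twisted derivation. Defining `der` by a formula also spares checking that
it respects the Clifford relations; `halfUnit` is chosen to give the right values on generators. -/
theorem der_mul (i : Fin (n - 1)) (x y : Cliff k n) :
    der i (x * y) = der i x * y + refl i x * der i y := by
  simp only [der_apply, map_mul, sub_mul, mul_sub, mul_assoc]
  abel

theorem der_e_lo (i : Fin (n - 1)) : der i (e k (lo i)) = 0 := by
  have a := e_anticomm (k := k) _ _ (lo_ne_hi i).symm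
  simp only [der_apply, permHom_e, simpleRefl_lo, halfUnit, mul_smul_comm, smul_mul_assoc, mul_add,
    add_mul, mul_one, one_mul, mul_assoc, a, mul_mul_of_mul_eq a, e_sq, neg_mul, mul_neg,
    mul_mul_of_mul_eq (e_sq (k := k) (lo i)), neg_neg]
  rw [add_comm, sub_self]

theorem der_e_far {i : Fin (n - 1)} {j : Fin n} (h₁ : j ≠ lo i) (h₂ : j ≠ hi i) :
    der i (e k j) = 0 := by
  have a₁ := e_anticomm (k := k) _ _ h₁
  have a₂ := e_anticomm (k := k) _ _ h₂
  simp only [der_apply, permHom_e, simpleRefl_of_ne h₁ h₂, halfUnit, mul_smul_comm, smul_mul_assoc,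
    mul_add, add_mul, mul_one, one_mul, mul_assoc, a₂, mul_mul_of_mul_eq a₁, neg_mul, mul_neg,
    neg_neg, sub_self]

theorem der_e_hi [CharZero k] (i : Fin (n - 1)) : der i (e k (hi i)) = e k (lo i) - e k (hi i) := by
  simp only [der_apply, permHom_e, simpleRefl_hi, halfUnit, mul_smul_comm, smul_mul_assoc, mul_add,
    add_mul, mul_one, one_mul, mul_assoc, e_sq, neg_mul, mul_neg,
    mul_mul_of_mul_eq (e_sq (k := k) (lo i))]
  rw [← smul_sub, show e k (lo i) + -e k (hi i) - (e k (hi i) + -e k (lo i)) =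
    (2 : k) • (e k (lo i) - e k (hi i)) by rw [two_smul]; abel, smul_smul,
    inv_mul_cancel₀ two_ne_zero, one_smul]

/-- Invariance and symmetry of the constant term turn the left side into that of `(s_i(u) - u) x`,
and `s_i(u) - u = -e_i e_{i+1}`. This is the source of the correction term in the Nakayama
automorphism. -/
theorem coeffOne_der [CharZero k] (i : Fin (n - 1)) (x : Cliff k n) :
    coeffOne (der i x) = -coeffOne (e k (lo i) * e k (hi i) * x) := by
  have h : refl i x * halfUnit k i = refl i (x * refl i (halfUnit k i)) := by
    have : refl i (refl i (halfUnit k i)) = halfUnit k i := by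
      simp [halfUnit, simpleRefl_lo, simpleRefl_hi]
    rw [map_mul, this]
  rw [der_apply, map_sub, h, coeffOne_permHom, coeffOne_mul_comm, ← map_sub, ← sub_mul,
    ← map_neg, ← neg_mul]
  congr 2
  have a := e_anticomm (k := k) _ _ (lo_ne_hi i).symm
  simp only [halfUnit, map_smul, map_add, map_one, map_mul, permHom_e, simpleRefl_lo, simpleRefl_hi]
  rw [← smul_sub, a, show (1 : Cliff k n) + -(e k (lo i) * e k (hi i)) -
    (1 + e k (lo i) * e k (hi i)) = (2 : k) • -(e k (lo i) * e k (hi i)) by rw [two_smul]; abel,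
    smul_smul, inv_mul_cancel₀ two_ne_zero, one_smul]

/-- Both corrections are determined by their values on generators, through multiplicativity of
`refl` and the twisted Leibniz rule. -/
theorem T_mul_cliffHom [CharZero k] (i : Fin (n - 1)) (x : Cliff k n) :
    T k i * cliffHom x = cliffHom (refl i x) * T k i + cliffHom (der i x) := by
  induction x using Cliff.induction with
  | one => simp
  | add x y hx hy => simp only [map_add, mul_add, add_mul, hx, hy]; abel
  | smul r x hx => simp only [map_smul, mul_smul_comm, smul_mul_assoc, hx, smul_add]
  | mul j x hx =>
    have key : T k i * c k j = c k (simpleRefl i j) * T k i + cliffHom (der i (e k j)) := by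
      by_cases h₁ : j = lo i
      · subst h₁; simp [simpleRefl_lo, der_e_lo, hcRelations.lo]
      by_cases h₂ : j = hi i
      · subst h₂
        rw [simpleRefl_hi, der_e_hi, hcRelations.hi, map_sub, cliffHom_e, cliffHom_e, add_sub]
      · simp [simpleRefl_of_ne h₁ h₂, der_e_far h₁ h₂, hcRelations.far _ _ h₁ h₂]
    rw [der_mul, map_mul, map_mul, map_add, map_mul, map_mul, map_mul, cliffHom_e,
      ← mul_assoc, key, permHom_e, cliffHom_e, add_mul, mul_assoc, hx, mul_add]
    simp only [mul_assoc]
    abel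

end Derivation

/-! ### The regular representation -/

section Regular

variable (k : Type*) [Field k] (n : ℕ)

/-- The underlying space of the regular representation: the function `f` stands for
`∑ w, f w T_w`. -/
abbrev RegSpace : Type _ := Equiv.Perm (Fin n) → Cliff k n

variable {k n}

/-- The action of `c j`. -/
noncomputable def regC (j : Fin n) : Module.End k (RegSpace k n) where
  toFun f w := e k j * f w
  map_add' f g := by ext; simp [mul_add]
  map_smul' r f := by ext; simp

/-- The action of `T i`. -/
noncomputable def regT (i : Fin (n - 1)) : Module.End k (RegSpace k n) where
  toFun f w := (if IsDescent i w then refl i (f (simpleRefl i * w) - f w) else 0) + der i (f w)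
  map_add' f g := by
    ext w
    simp only [Pi.add_apply, map_add, map_sub]
    split_ifs <;> abel
  map_smul' r f := by
    ext w
    simp only [Pi.smul_apply, map_smul, map_sub, RingHom.id_apply, smul_add]
    split_ifs <;> simp [smul_sub]

theorem regC_apply (j : Fin n) (f : RegSpace k n) (w : Equiv.Perm (Fin n)) :
    regC j f w = e k j * f w := rfl

theorem regT_apply (i : Fin (n - 1)) (f : RegSpace k n) (w : Equiv.Perm (Fin n)) :
    regT i f w =
      (if IsDescent i w then refl i (f (simpleRefl i * w) - f w) else 0) + der i (f w) := rfl

theorem regT_mul_regC_apply (i : Fin (n - 1)) (j : Fin n) (f : RegSpace k n)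
    (w : Equiv.Perm (Fin n)) :
    regT i (regC j f) w = e k (simpleRefl i j) * regT i f w + der i (e k j) * f w := by
  simp only [regT_apply, regC_apply, ← mul_sub, map_mul, permHom_e, der_mul, mul_add]
  split_ifs <;> simp <;> abel

theorem reg_mixedRelations [CharZero k] :
    MixedRelations (regT (k := k) (n := n)) regC where
  far i j h₁ h₂ := by
    refine LinearMap.ext fun f => funext fun w => ?_
    rw [Module.End.mul_apply, Module.End.mul_apply, regT_mul_regC_apply, der_e_far h₁ h₂, zero_mul,
      add_zero, simpleRefl_of_ne h₁ h₂, regC_apply]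
  lo i := by
    refine LinearMap.ext fun f => funext fun w => ?_
    rw [Module.End.mul_apply, Module.End.mul_apply, regT_mul_regC_apply, der_e_lo, zero_mul,
      add_zero, simpleRefl_lo, regC_apply]
  hi i := by
    refine LinearMap.ext fun f => funext fun w => ?_
    simp only [Module.End.mul_apply, LinearMap.add_apply, LinearMap.sub_apply, Pi.add_apply,
      Pi.sub_apply, regC_apply]
    rw [regT_mul_regC_apply, der_e_hi, simpleRefl_hi, sub_mul, add_sub]

/-- The action of `T i` on scalar functions. -/
def scalarT (i : Fin (n - 1)) (g : Equiv.Perm (Fin n) → k) (w : Equiv.Perm (Fin n)) : k :=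
  if IsDescent i w then g (simpleRefl i * w) - g w else 0

/-- On scalar functions the derivation term disappears, leaving the regular action of the 0-Hecke
algebra. -/
theorem regT_scalar (i : Fin (n - 1)) (g : Equiv.Perm (Fin n) → k) :
    regT i (fun w => g w • (1 : Cliff k n)) = fun w => scalarT i g w • 1 := by
  ext w
  simp only [regT_apply, map_smul, der_one, smul_zero, add_zero, scalarT]
  split_ifs <;> simp [sub_smul]

theorem scalarT_sq (i : Fin (n - 1)) (g : Equiv.Perm (Fin n) → k) :
    scalarT i (scalarT i g) = -scalarT i g := by
  ext w
  simp only [scalarT, isDescent_simpleRefl_mul, Pi.neg_apply]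
  split_ifs <;> simp_all

theorem isDescent_simpleRefl_mul_of_far {i j : Fin (n - 1)} {w : Equiv.Perm (Fin n)}
    (h : (i : ℕ) + 1 < j ∨ (j : ℕ) + 1 < i) :
    IsDescent j (simpleRefl i * w) ↔ IsDescent j w :=
  ⟨fun h' => by simpa using h'.simpleRefl_mul_of_far h, fun h' => h'.simpleRefl_mul_of_far h⟩

theorem scalarT_comm {i j : Fin (n - 1)} (h : (i : ℕ) + 1 < j ∨ (j : ℕ) + 1 < i)
    (g : Equiv.Perm (Fin n) → k) : scalarT i (scalarT j g) = scalarT j (scalarT i g) := by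
  ext w
  have : simpleRefl j * (simpleRefl i * w) = simpleRefl i * (simpleRefl j * w) := by
    rw [← mul_assoc, simpleRefl_comm h.symm, mul_assoc]
  simp only [scalarT, isDescent_simpleRefl_mul_of_far h, isDescent_simpleRefl_mul_of_far h.symm,
    this]
  split_ifs <;> ring

theorem scalarT_braid {i j : Fin (n - 1)} (hij : (j : ℕ) = i + 1)
    (g : Equiv.Perm (Fin n) → k) :
    scalarT i (scalarT j (scalarT i g)) = scalarT j (scalarT i (scalarT j g)) := by
  ext w
  have hji := hi_eq_lo hij
  have e₁ : simpleRefl i (hi j) = hi j :=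
    simpleRefl_of_ne (by simp only [lo, hi, ne_eq, Fin.ext_iff]; omega)
      (by simp only [hi, ne_eq, Fin.ext_iff]; omega)
  have e₂ : simpleRefl j (lo i) = lo i :=
    simpleRefl_of_ne (by simp only [lo, ne_eq, Fin.ext_iff]; omega)
      (by simp only [lo, hi, ne_eq, Fin.ext_iff]; omega)
  have e₃ : simpleRefl i (lo j) = lo i := by rw [← hji, simpleRefl_hi]
  have hb : simpleRefl i * (simpleRefl j * (simpleRefl i * w)) =
      simpleRefl j * (simpleRefl i * (simpleRefl j * w)) := by
    simpa only [mul_assoc] using congrArg (· * w) (simpleRefl_braid hij)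
  have d₁ : IsDescent j (simpleRefl i * w) ↔ w⁻¹ (hi j) < w⁻¹ (lo i) := by
    rw [IsDescent, inv_simpleRefl_mul_apply, inv_simpleRefl_mul_apply, e₁, e₃]
  have d₂ : IsDescent i (simpleRefl j * w) ↔ w⁻¹ (hi j) < w⁻¹ (lo i) := by
    rw [IsDescent, inv_simpleRefl_mul_apply, inv_simpleRefl_mul_apply, e₂, hji, simpleRefl_lo]
  have d₃ : IsDescent i (simpleRefl j * (simpleRefl i * w)) ↔ IsDescent j w := by
    simp only [IsDescent, inv_simpleRefl_mul_apply, e₂, hji, simpleRefl_lo, e₁]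
  have d₄ : IsDescent j (simpleRefl i * (simpleRefl j * w)) ↔ IsDescent i w := by
    simp only [IsDescent, inv_simpleRefl_mul_apply, e₁, e₃, simpleRefl_hi, e₂, hji]
  have d₅ : IsDescent i w → IsDescent j w → w⁻¹ (hi j) < w⁻¹ (lo i) := fun h h' => by
    rw [IsDescent, hji] at h
    exact lt_trans h' h
  -- Every descent condition is now a comparison among the three positions `w⁻¹ (lo i)`, `w⁻¹ (lo
  -- j)`, `w⁻¹ (hi j)`.
  simp only [scalarT, isDescent_simpleRefl_mul, d₁, d₂, d₃, d₄, hb, simpleRefl_mul_cancel]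
  by_cases h₁ : IsDescent i w <;> by_cases h₂ : IsDescent j w
  · simp only [h₁, h₂, d₅ h₁ h₂, if_true, not_true, if_false]
    ring
  · simp only [h₁, h₂, if_true, not_true, not_false_iff, if_false]
    split_ifs <;> ring
  · simp only [h₁, h₂, if_true, not_true, not_false_iff, if_false]
    split_ifs <;> ring
  · simp only [h₁, h₂, if_false]

/-- The Clifford generators produce all functions from the scalar ones, and an operator that passes
through them up to renumbering carries its vanishing along. -/
theorem eq_zero_of_scalar {D : Module.End k (RegSpace k n)}
    (hD : ∀ p, ∃ q, D * regC p = regC q * D)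
    (h : ∀ g : Equiv.Perm (Fin n) → k, D (fun w => g w • 1) = 0) : D = 0 := by
  have key : ∀ (x : Cliff k n) (g : Equiv.Perm (Fin n) → k), D (fun w => g w • x) = 0 := by
    intro x
    induction x using Cliff.induction with
    | one => exact h
    | add x y hx hy =>
      intro g
      have : (fun w => g w • (x + y)) = (fun w => g w • x) + fun w => g w • y := by
        ext; simp
      rw [this, map_add, hx, hy, add_zero]
    | smul r x hx =>
      intro g
      have : (fun w => g w • r • x) = r • fun w => g w • x := by
        ext w; exact smul_comm _ _ _
      rw [this, map_smul, hx, smul_zero]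
    | mul j x hx =>
      intro g
      obtain ⟨q, hq⟩ := hD j
      have : (fun w => g w • (e k j * x)) = regC j fun w => g w • x := by
        ext w; simp [regC_apply]
      rw [this, ← Module.End.mul_apply, hq, Module.End.mul_apply, hx, map_zero]
  refine LinearMap.pi_ext fun w x => ?_
  rw [LinearMap.zero_apply, ← key x (Pi.single w 1)]
  congr 1
  ext w'
  by_cases hw : w' = w
  · subst hw; simp
  · simp [hw]

theorem reg_hcRelations [CharZero k] : HCRelations (regT (k := k) (n := n)) regC := by
  have T_sq : ∀ i, regT (k := k) (n := n) i * regT i = -regT i := by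
    intro i
    rw [eq_neg_iff_add_eq_zero]
    refine eq_zero_of_scalar (fun p => ⟨p, reg_mixedRelations.sq_add_mul i p⟩) fun g => ?_
    ext w
    simp [regT_scalar, scalarT_sq]
  refine ⟨reg_mixedRelations, T_sq, fun i j hij => ?_, fun i j hij => ?_, fun j => ?_,
    fun i j hij => ?_⟩
  · rw [← sub_eq_zero]
    refine eq_zero_of_scalar (reg_mixedRelations.comm_sub_mul hij) fun g => ?_
    simp only [LinearMap.sub_apply, Module.End.mul_apply, regT_scalar, scalarT_comm hij, sub_self]
  · rw [← sub_eq_zero]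
    refine eq_zero_of_scalar (reg_mixedRelations.braid_sub_mul T_sq hij) fun g => ?_
    simp only [LinearMap.sub_apply, Module.End.mul_apply, regT_scalar, scalarT_braid hij, sub_self]
  · refine LinearMap.ext fun f => funext fun w => ?_
    simp [regC_apply, ← mul_assoc, e_sq]
  · refine LinearMap.ext fun f => funext fun w => ?_
    simp [regC_apply, ← mul_assoc, e_anticomm _ _ hij]

/-- The regular representation. -/
noncomputable def reg [CharZero k] : HC k n →ₐ[k] Module.End k (RegSpace k n) :=
  HC.lift reg_hcRelations

end Regular

/-! ### The basis theorem -/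

section Basis

variable {k : Type*} [Field k] {n : ℕ}

theorem TProd_cons (i : Fin (n - 1)) (l : List (Fin (n - 1))) :
    TProd k (i :: l) = T k i * TProd k l := rfl

theorem TProd_append (l l' : List (Fin (n - 1))) :
    TProd k (l ++ l') = TProd k l * TProd k l' := by simp [TProd]

theorem TProd_eq_of_isReducedExpr {l l' : List (Fin (n - 1))} {w : Equiv.Perm (Fin n)}
    (h : IsReducedExpr l w) (h' : IsReducedExpr l' w) : TProd k l = TProd k l' :=
  prod_eq_of_isReducedExpr _ hcRelations.T_comm hcRelations.T_braid h h'

theorem T_mul_TProd {l : List (Fin (n - 1))} {w : Equiv.Perm (Fin n)} (h : IsReducedExpr l w)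
    {i : Fin (n - 1)} (hi : IsDescent i w) : T k i * TProd k l = -TProd k l := by
  obtain ⟨m, hm⟩ := exists_isReducedExpr (simpleRefl i * w)
  rw [TProd_eq_of_isReducedExpr h (isReducedExpr_cons_iff.2 ⟨hm, hi⟩), TProd_cons, ← mul_assoc,
    hcRelations.T_sq, HC.neg_mul]

theorem TProd_mul_T {l : List (Fin (n - 1))} {w : Equiv.Perm (Fin n)} (h : IsReducedExpr l w)
    {i : Fin (n - 1)} (hi : IsDescent i w⁻¹) : TProd k l * T k i = -TProd k l := by
  obtain ⟨m, hm⟩ := exists_isReducedExpr (simpleRefl i * w⁻¹)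
  have := (isReducedExpr_cons_iff.2 ⟨hm, hi⟩).reverse
  rw [inv_inv, List.reverse_cons] at this
  have hT : TProd k [i] = T k i := by simp [TProd]
  rw [TProd_eq_of_isReducedExpr h this, TProd_append, hT, mul_assoc, hcRelations.T_sq, HC.mul_neg]

/-- A reduced expression. -/
noncomputable def word (w : Equiv.Perm (Fin n)) : List (Fin (n - 1)) :=
  (exists_isReducedExpr w).choose

theorem isReducedExpr_word (w : Equiv.Perm (Fin n)) : IsReducedExpr (word w) w :=
  (exists_isReducedExpr w).choose_spec

theorem isReducedExpr_nil : IsReducedExpr ([] : List (Fin (n - 1))) 1 :=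
  isReducedExpr_iff.2 (by simp)

/-- The element `∑ w, f w T_w`. -/
noncomputable def fromReg : RegSpace k n →ₗ[k] HC k n :=
  ∑ w, LinearMap.mulRight k (TProd k (word w)) ∘ₗ cliffHom.toLinearMap ∘ₗ LinearMap.proj w

theorem fromReg_apply (f : RegSpace k n) :
    fromReg f = ∑ w, cliffHom (f w) * TProd k (word w) := by
  simp [fromReg]

theorem fromReg_single (w : Equiv.Perm (Fin n)) (x : Cliff k n) :
    fromReg (Pi.single w x) = cliffHom x * TProd k (word w) := by
  rw [fromReg_apply, Finset.sum_eq_single w]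
  · simp
  · intro w' _ h; simp [h]
  · simp

/-- The pointwise formula for `regT` collects coefficients; this is the same action on a single term
`x T_w`, the form comparable with multiplication in the algebra. -/
theorem regT_single (i : Fin (n - 1)) (w : Equiv.Perm (Fin n)) (x : Cliff k n) :
    regT i (Pi.single w x) = (if IsDescent i w then -Pi.single w (refl i x)
      else Pi.single (simpleRefl i * w) (refl i x)) + Pi.single w (der i x) := by
  have hne : simpleRefl i * w ≠ w := fun h => by
    have h₁ := isDescent_simpleRefl_mul (i := i) (w := w)
    rw [h] at h₁
    tauto
  ext v
  rw [regT_apply]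
  by_cases h₁ : v = w
  · subst h₁
    simp only [Pi.single_eq_same, Pi.single_eq_of_ne hne, Pi.add_apply, zero_sub, map_neg]
    split_ifs
    · simp
    · simp [Pi.single_eq_of_ne hne.symm]
  by_cases h₂ : v = simpleRefl i * w
  · subst h₂
    simp only [simpleRefl_mul_cancel, Pi.single_eq_same, Pi.single_eq_of_ne hne, Pi.add_apply,
      sub_zero, map_zero, isDescent_simpleRefl_mul, ite_not]
    split_ifs
    · simp [Pi.single_eq_of_ne hne]
    · simp
  · have h₃ : simpleRefl i * v ≠ w := fun h => h₂ (by rw [← h, simpleRefl_mul_cancel])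
    simp only [Pi.single_eq_of_ne h₁, Pi.single_eq_of_ne h₃, Pi.add_apply, sub_zero, map_zero,
      ite_self, add_zero]
    split_ifs
    · simp [Pi.single_eq_of_ne h₁]
    · simp [Pi.single_eq_of_ne h₂]

theorem fromReg_regC (j : Fin n) (f : RegSpace k n) :
    fromReg (regC j f) = c k j * fromReg f := by
  simp [fromReg_apply, regC_apply, Finset.mul_sum, mul_assoc]

variable [CharZero k]

theorem fromReg_regT (i : Fin (n - 1)) (f : RegSpace k n) :
    fromReg (regT i f) = T k i * fromReg f := by
  suffices h : fromReg ∘ₗ regT i = LinearMap.mulLeft k (T k i) ∘ₗ fromReg from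
    LinearMap.congr_fun h f
  refine LinearMap.pi_ext fun w x => ?_
  simp only [LinearMap.comp_apply, LinearMap.mulLeft_apply, regT_single, map_add, fromReg_single]
  rw [← mul_assoc, T_mul_cliffHom, add_mul, mul_assoc]
  congr 1
  split_ifs with h
  · rw [map_neg, fromReg_single, T_mul_TProd (isReducedExpr_word w) h, HC.mul_neg]
  · rw [fromReg_single, ← TProd_cons, TProd_eq_of_isReducedExpr (isReducedExpr_word _)
      ((isReducedExpr_word w).cons h)]

@[simp] theorem reg_T (i : Fin (n - 1)) : reg (T k i) = regT i := HC.lift_T _ _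

@[simp] theorem reg_c (j : Fin n) : reg (c k j) = regC j := HC.lift_c _ _

theorem fromReg_reg (h : HC k n) (f : RegSpace k n) : fromReg (reg h f) = h * fromReg f := by
  induction h using HC.induction with
  | one => simp
  | add x y hx hy => simp [hx, hy, add_mul]
  | smul r x hx => simp [hx]
  | T_mul i x hx => simp [fromReg_regT, hx, mul_assoc]
  | c_mul j x hx => simp [fromReg_regC, hx, mul_assoc]

/-- The coordinates of an element with respect to the `T_w`. -/
noncomputable def toReg : HC k n →ₗ[k] RegSpace k n :=
  LinearMap.applyₗ (Pi.single 1 1) ∘ₗ reg.toLinearMap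

theorem toReg_apply (h : HC k n) : toReg h = reg h (Pi.single 1 1) := rfl

theorem toReg_mul (g h : HC k n) : toReg (g * h) = reg g (toReg h) := by
  simp [toReg_apply]

/-- `fromReg` intertwines the regular representation with left multiplication and sends the cyclic
vector to `1`. -/
theorem fromReg_toReg (h : HC k n) : fromReg (toReg h) = h := by
  rw [toReg_apply, fromReg_reg, fromReg_single,
    TProd_eq_of_isReducedExpr (isReducedExpr_word _) isReducedExpr_nil]
  simp [TProd]

theorem toReg_injective : Function.Injective (toReg (k := k) (n := n)) :=
  Function.LeftInverse.injective fromReg_toReg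

theorem finiteDimensional_HC : FiniteDimensional k (HC k n) :=
  FiniteDimensional.of_injective toReg toReg_injective

theorem reg_cliffHom (x : Cliff k n) (f : RegSpace k n) (w : Equiv.Perm (Fin n)) :
    reg (cliffHom x) f w = x * f w := by
  induction x using Cliff.induction with
  | one => simp
  | add x y hx hy => simp [hx, hy, add_mul]
  | smul r x hx => simp [hx]
  | mul j x hx => simp [regC_apply, hx, mul_assoc]

theorem toReg_TProd {l : List (Fin (n - 1))} {w : Equiv.Perm (Fin n)} (h : IsReducedExpr l w) :
    toReg (TProd k l) = Pi.single w 1 := by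
  induction l generalizing w with
  | nil =>
    obtain rfl : 1 = w := h.1
    simp [TProd, toReg_apply]
  | cons i l ih =>
    obtain ⟨h₁, h₂⟩ := isReducedExpr_cons_iff.1 h
    rw [TProd_cons, toReg_mul, ih h₁, reg_T, regT_single, if_neg, simpleRefl_mul_cancel]
    · simp
    · rwa [isDescent_simpleRefl_mul, not_not]

/-- Each letter raises the length of the support by at most one. The word need not be reduced, so
lower-order terms never have to be rewritten in reduced form. -/
theorem toReg_TProd_apply_eq_zero {l : List (Fin (n - 1))} {w : Equiv.Perm (Fin n)}
    (h : l.length < inv w) : toReg (TProd k l) w = 0 := by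
  induction l generalizing w with
  | nil =>
    have : w ≠ 1 := by rintro rfl; simp at h
    simp [TProd, toReg_apply, this]
  | cons i l ih =>
    rw [List.length_cons] at h
    have := inv_simpleRefl_mul_le i (simpleRefl i * w)
    rw [simpleRefl_mul_cancel] at this
    rw [TProd_cons, toReg_mul, reg_T, regT_apply, ih (w := w) (by omega),
      ih (w := simpleRefl i * w) (by omega)]
    simp

theorem HC.linearMap_ext {M : Type*} [AddCommGroup M] [Module k M] {f g : HC k n →ₗ[k] M}
    (h : ∀ (x : Cliff k n) (l : List (Fin (n - 1))) (w : Equiv.Perm (Fin n)), IsReducedExpr l w →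
      f (cliffHom x * TProd k l) = g (cliffHom x * TProd k l)) : f = g := by
  refine LinearMap.ext fun a => ?_
  rw [← fromReg_toReg a, fromReg_apply, map_sum, map_sum]
  exact Finset.sum_congr rfl fun w _ => h _ _ _ (isReducedExpr_word w)

end Basis

/-! ### The trace -/

section Trace

variable {k : Type*} [Field k] {n : ℕ} [CharZero k]

variable (k n) in
/-- The trace: the coefficient of `T_{w_0}`. -/
noncomputable def trace : HC k n →ₗ[k] k := coeffOne ∘ₗ LinearMap.proj (longest n) ∘ₗ toReg

theorem trace_apply (h : HC k n) : trace k n h = coeffOne (toReg h (longest n)) := rfl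

theorem trace_cliffHom_mul (x : Cliff k n) (h : HC k n) :
    trace k n (cliffHom x * h) = coeffOne (x * toReg h (longest n)) := by
  rw [trace_apply, toReg_mul, reg_cliffHom]

theorem trace_cliffHom_mul_TProd (x : Cliff k n) {l : List (Fin (n - 1))}
    {w : Equiv.Perm (Fin n)} (h : IsReducedExpr l w) :
    trace k n (cliffHom x * TProd k l) = if w = longest n then coeffOne x else 0 := by
  rw [trace_cliffHom_mul, toReg_TProd h]
  split_ifs with hw
  · simp [hw]
  · simp [Ne.symm hw]

theorem hasTraceValues_trace : HasTraceValues (trace k n) := by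
  intro D w l hl
  rw [← cliffHom_orderedProd, trace_cliffHom_mul_TProd _ hl, coeffOne_orderedProd]
  split_ifs <;> simp_all

theorem eq_of_hasTraceValues {f g : HC k n →ₗ[k] k} (hf : HasTraceValues f)
    (hg : HasTraceValues g) : f = g := by
  refine HC.linearMap_ext fun x l w hl => ?_
  suffices h : f ∘ₗ LinearMap.mulRight k (TProd k l) ∘ₗ cliffHom.toLinearMap =
      g ∘ₗ LinearMap.mulRight k (TProd k l) ∘ₗ cliffHom.toLinearMap from LinearMap.congr_fun h x
  refine linearMap_ext_orderedProd fun D => ?_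
  simp only [LinearMap.comp_apply, AlgHom.toLinearMap_apply, LinearMap.mulRight_apply,
    cliffHom_orderedProd]
  rw [hf D w l hl, hg D w l hl]

theorem inv_le_inv_longest (w : Equiv.Perm (Fin n)) : inv w ≤ inv (longest n) := by
  refine Finset.card_le_card fun x hx => ?_
  simp only [inversions, Finset.mem_filter, Finset.mem_univ, true_and, longest_inv] at hx ⊢
  exact ⟨hx.1, Fin.rev_lt_rev.2 hx.1⟩

theorem trace_no_left_ideal (I : Ideal (HC k n)) (hI : ∀ a ∈ I, trace k n a = 0) : I = ⊥ := by
  have key : ∀ (m : ℕ) (w : Equiv.Perm (Fin n)), inv (longest n) - inv w = m →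
      ∀ a ∈ I, toReg a w = 0 := by
    intro m
    induction m with
    | zero =>
      intro w hm a ha
      have hw : w = longest n := by
        by_contra hw
        obtain ⟨i, hi⟩ := exists_not_isDescent hw
        have h₁ := inv_simpleRefl_mul_of_not hi
        have h₂ := inv_le_inv_longest (simpleRefl i * w)
        omega
      subst hw
      refine eq_zero_of_coeffOne fun y => ?_
      rw [← trace_cliffHom_mul]
      exact hI _ (I.mul_mem_left _ ha)
    | succ m ih =>
      intro w hm a ha
      have hw : w ≠ longest n := by rintro rfl; omega
      obtain ⟨i, hi⟩ := exists_not_isDescent hw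
      have h₁ := inv_simpleRefl_mul_of_not hi
      -- The coordinate of `T_i a` at `s_i w` involves only those of `a` at `w` and at `s_i w`. The
      -- latter vanishes by induction, leaving `s_i` applied to the coordinate at `w`.
      have h₂ := ih (simpleRefl i * w) (by omega) (T k i * a) (I.mul_mem_left _ ha)
      rw [toReg_mul, reg_T, regT_apply, if_pos (isDescent_simpleRefl_mul.2 hi),
        simpleRefl_mul_cancel, ih (simpleRefl i * w) (by omega) a ha, sub_zero, map_zero,
        add_zero] at h₂
      have h₃ : refl i (refl i (toReg a w)) = toReg a w := by
        suffices h : (refl i).comp (refl i) = AlgHom.id k (Cliff k n) from AlgHom.congr_fun h _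
        refine AlgHom.ext fun x => ?_
        induction x using Cliff.induction with
        | one => simp
        | add x y hx hy => rw [map_add, hx, hy, map_add]
        | smul r x hx => rw [map_smul, hx, map_smul]
        | mul j x hx => rw [map_mul, hx, map_mul]; simp
      rw [← h₃, h₂, map_zero]
  refine (Submodule.eq_bot_iff _).2 fun a ha => toReg_injective ?_
  rw [map_zero]
  exact funext fun w => key _ w rfl a ha

/-! ### The trace and right multiplication by generators -/

variable (k) in
/-- The span of the `x T_l` with `x` in the Clifford algebra and `l` of length less than `m`. -/
noncomputable def shorter (n m : ℕ) : Submodule k (HC k n) :=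
  Submodule.span k {a | ∃ (x : Cliff k n) (l : List (Fin (n - 1))), l.length < m ∧
    cliffHom x * TProd k l = a}

omit [CharZero k] in
theorem mem_shorter {m : ℕ} (x : Cliff k n) {l : List (Fin (n - 1))} (h : l.length < m) :
    cliffHom x * TProd k l ∈ shorter k n m := Submodule.subset_span ⟨x, l, h, rfl⟩

omit [CharZero k] in
theorem shorter_mono {m m' : ℕ} (h : m ≤ m') : shorter k n m ≤ shorter k n m' :=
  Submodule.span_mono (by rintro _ ⟨x, l, hl, rfl⟩; exact ⟨x, l, hl.trans_le h, rfl⟩)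

theorem T_mul_mem_shorter {m : ℕ} (i : Fin (n - 1)) {a : HC k n} (ha : a ∈ shorter k n m) :
    T k i * a ∈ shorter k n (m + 1) := by
  induction ha using Submodule.span_induction with
  | mem a h =>
    obtain ⟨x, l, hl, rfl⟩ := h
    rw [← mul_assoc, T_mul_cliffHom, add_mul, mul_assoc, ← TProd_cons]
    exact add_mem (mem_shorter _ (by simpa using hl)) (mem_shorter _ (by omega))
  | zero => simp
  | add x y _ _ hx hy => rw [mul_add]; exact add_mem hx hy
  | smul r x _ hx => rw [mul_smul_comm]; exact Submodule.smul_mem _ _ hx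

/-- Each letter of the word permutes the index of `c`, and each derivation term drops that letter.
-/
theorem TProd_mul_c (l : List (Fin (n - 1))) (j : Fin n) :
    TProd k l * c k j - c k (wordProd l j) * TProd k l ∈ shorter k n l.length := by
  induction l with
  | nil => simp [TProd]
  | cons i l ih =>
    have h := T_mul_mem_shorter i ih
    have h₁ := T_mul_cliffHom i (e k (wordProd l j))
    rw [cliffHom_e, permHom_e, cliffHom_e] at h₁
    have h₂ : TProd k (i :: l) * c k j - c k (wordProd (i :: l) j) * TProd k (i :: l) =
        T k i * (TProd k l * c k j - c k (wordProd l j) * TProd k l) +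
          cliffHom (der i (e k (wordProd l j))) * TProd k l := by
      rw [mul_sub, ← mul_assoc (T k i) (c k _), h₁, TProd_cons, wordProd_cons,
        Equiv.Perm.mul_apply, add_mul, mul_assoc, mul_assoc]
      abel
    rw [h₂]
    exact add_mem h (mem_shorter _ (by simp))

theorem trace_cliffHom_mul_of_mem_shorter (x : Cliff k n) {a : HC k n}
    (ha : a ∈ shorter k n (inv (longest n))) : trace k n (cliffHom x * a) = 0 := by
  induction ha using Submodule.span_induction with
  | mem a h =>
    obtain ⟨y, l, hl, rfl⟩ := h
    rw [← mul_assoc, ← map_mul, trace_cliffHom_mul, toReg_TProd_apply_eq_zero hl, mul_zero,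
      map_zero]
  | zero => simp
  | add x y _ _ hx hy => rw [mul_add, map_add, hx, hy, add_zero]
  | smul r x _ hx => rw [mul_smul_comm, map_smul, hx, smul_zero]

/-- The trace ignores terms shorter than `w₀`, so only the leading term of `T_w c_j` counts, and
only for `w = w₀`, which reverses the index. Symmetry of the Clifford form then moves the generator
to the left. -/
theorem trace_mul_c (a : HC k n) (j : Fin n) :
    trace k n (a * c k j) = trace k n (c k j.rev * a) := by
  suffices h : trace k n ∘ₗ LinearMap.mulRight k (c k j) =
      trace k n ∘ₗ LinearMap.mulLeft k (c k j.rev) from LinearMap.congr_fun h a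
  refine HC.linearMap_ext fun x l w hl => ?_
  have hlen : l.length ≤ inv (longest n) :=
    (isReducedExpr_iff.1 hl).2.trans_le (inv_le_inv_longest w)
  have h := trace_cliffHom_mul_of_mem_shorter x (shorter_mono hlen (TProd_mul_c l j))
  rw [mul_sub, map_sub, sub_eq_zero, ← cliffHom_e, ← cliffHom_e, ← mul_assoc, ← mul_assoc,
    ← map_mul, trace_cliffHom_mul_TProd _ hl] at h
  simp only [LinearMap.comp_apply, LinearMap.mulRight_apply, LinearMap.mulLeft_apply]
  rw [← cliffHom_e, ← cliffHom_e, h, ← mul_assoc, ← map_mul, trace_cliffHom_mul_TProd _ hl,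
    coeffOne_mul_comm]
  split_ifs with hw
  · have : wordProd l = longest n := hl.1.trans hw
    rw [this]; rfl
  · rfl

theorem simpleRefl_rev_mul_longest (i : Fin (n - 1)) :
    simpleRefl i.rev * longest n = longest n * simpleRefl i := by
  have := Equiv.mul_swap_eq_swap_mul (longest n) (lo i) (hi i)
  rw [simpleRefl, simpleRefl, this, lo_rev, hi_rev, Equiv.swap_comm]
  rfl

theorem trace_mul_T (a : HC k n) (i : Fin (n - 1)) :
    trace k n (a * T k i) =
      trace k n ((T k i.rev + c k (lo i.rev) * c k (hi i.rev)) * a) := by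
  suffices h : trace k n ∘ₗ LinearMap.mulRight k (T k i) =
      trace k n ∘ₗ LinearMap.mulLeft k (T k i.rev + c k (lo i.rev) * c k (hi i.rev)) from
    LinearMap.congr_fun h a
  refine HC.linearMap_ext fun x l w hl => ?_
  simp only [LinearMap.comp_apply, LinearMap.mulRight_apply, LinearMap.mulLeft_apply]
  have hL : trace k n (cliffHom x * TProd k l * T k i) = if w = longest n then -coeffOne x else
      if w * simpleRefl i = longest n then coeffOne x else 0 := by
    rw [mul_assoc]
    by_cases hd : IsDescent i w⁻¹
    · rw [TProd_mul_T hl hd, HC.mul_neg, map_neg, trace_cliffHom_mul_TProd _ hl]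
      have : w * simpleRefl i ≠ longest n := by
        intro h
        have h' : simpleRefl i * w⁻¹ = longest n := by
          rw [← longest_inv, ← h, mul_inv_rev, simpleRefl_inv]
        have := isDescent_longest (n := n) i
        rw [← h', isDescent_simpleRefl_mul] at this
        exact this hd
      rw [if_neg this]
      split_ifs <;> simp
    · have hr := (hl.reverse.cons hd).reverse
      rw [List.reverse_cons, List.reverse_reverse, mul_inv_rev, inv_inv, simpleRefl_inv] at hr
      have hT : T k i = TProd k [i] := by simp [TProd]
      have hw : w ≠ longest n := by
        rintro rfl
        rw [longest_inv] at hd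
        exact hd (isDescent_longest i)
      rw [hT, ← TProd_append, trace_cliffHom_mul_TProd _ hr, if_neg hw]
  have hR : trace k n (cliffHom (refl i.rev x) * (T k i.rev * TProd k l)) =
      if w = longest n then -coeffOne x else
      if simpleRefl i.rev * w = longest n then coeffOne x else 0 := by
    by_cases hd : IsDescent i.rev w
    · rw [T_mul_TProd hl hd, HC.mul_neg, map_neg, trace_cliffHom_mul_TProd _ hl, coeffOne_permHom]
      have : simpleRefl i.rev * w ≠ longest n := by
        intro h
        have := isDescent_longest (n := n) i.rev
        rw [← h, isDescent_simpleRefl_mul] at this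
        exact this hd
      rw [if_neg this]
      split_ifs <;> simp
    · have hw : w ≠ longest n := by
        rintro rfl
        exact hd (isDescent_longest _)
      rw [← TProd_cons, trace_cliffHom_mul_TProd _ (hl.cons hd), coeffOne_permHom, if_neg hw]
  -- Conjugation by `w₀` reverses the simple transpositions, so the right and left neighbours of
  -- `w₀` match up.
  have hiff : w * simpleRefl i = longest n ↔ simpleRefl i.rev * w = longest n := by
    rw [← eq_mul_inv_iff_mul_eq, simpleRefl_inv, ← simpleRefl_rev_mul_longest,
      ← eq_inv_mul_iff_mul_eq, simpleRefl_inv]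
  -- The correction in the twist cancels the derivation term.
  have h₀ : trace k n (cliffHom (der i.rev x) * TProd k l) +
      trace k n (c k (lo i.rev) * c k (hi i.rev) * (cliffHom x * TProd k l)) = 0 := by
    rw [← cliffHom_e, ← cliffHom_e, ← map_mul, ← mul_assoc, ← map_mul,
      trace_cliffHom_mul_TProd _ hl, trace_cliffHom_mul_TProd _ hl, coeffOne_der]
    split_ifs <;> simp
  rw [hL, add_mul, ← mul_assoc (T k _), T_mul_cliffHom, add_mul, mul_assoc, map_add, map_add,
    add_assoc, h₀, add_zero, hR]
  simp only [hiff]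

/-! ### Parity -/

variable (k n) in
/-- The parity automorphism. -/
noncomputable def parityHom : HC k n →ₐ[k] HC k n := HC.lift hcRelations.neg

theorem zmod_two_cases (a : ZMod 2) : a = 0 ∨ a = 1 := by revert a; decide

theorem zmod_two_one_add_one : (1 : ZMod 2) + 1 = 0 := rfl

omit [CharZero k] in
theorem neg_one_pow_val_add (a b : ZMod 2) :
    (-1 : k) ^ (a + b).val = (-1) ^ a.val * (-1) ^ b.val := by
  rcases zmod_two_cases a with rfl | rfl <;> rcases zmod_two_cases b with rfl | rfl <;>
    simp [ZMod.val_one, zmod_two_one_add_one]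

omit [CharZero k] in
theorem parityHom_of_mem {d : ZMod 2} {a : HC k n} (ha : a ∈ parity k n d) :
    parityHom k n a = (-1 : k) ^ d.val • a := by
  induction ha using Submodule.span_induction with
  | mem a h =>
    obtain ⟨l, rfl, rfl⟩ := h
    induction l with
    | nil => simp
    | cons g l ih =>
      simp only [List.map_cons, List.prod_cons, List.sum_cons, map_mul, ih, neg_one_pow_val_add]
      cases g with
      | T i =>
        have : parityHom k n (gen k (Gen.T i)) = gen k (Gen.T i) := HC.lift_T _ i
        simp [this, Gen.deg]
      | c j =>
        have : parityHom k n (gen k (Gen.c j)) = -gen k (Gen.c j) := HC.lift_c _ j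
        rw [this, HC.neg_mul, HC.neg_eq_smul, mul_smul_comm, smul_smul, Gen.deg,
          ZMod.val_one, pow_one]
  | zero => simp
  | add x y _ _ hx hy => rw [map_add, hx, hy, smul_add]
  | smul r x _ hx => rw [map_smul, hx, smul_comm]

/-- The sign `(-1) ^ D.card` is trivial at the only `D` with a nonzero prescribed value, so
uniqueness of the trace applies. -/
theorem trace_parityHom (a : HC k n) : trace k n (parityHom k n a) = trace k n a := by
  suffices h : trace k n ∘ₗ (parityHom k n).toLinearMap = trace k n from LinearMap.congr_fun h a
  refine eq_of_hasTraceValues (fun D w l hl => ?_) hasTraceValues_trace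
  have h₁ : parityHom k n (TProd k l) = TProd k l := by
    simp [TProd, map_list_prod, parityHom, Function.comp_def]
  have h₂ : parityHom k n (cProd k D) = (-1 : k) ^ D.card • cProd k D := by
    have : ∀ L : List (Fin n), parityHom k n (L.map (c k)).prod =
        (-1 : k) ^ L.length • (L.map (c k)).prod := by
      intro L
      induction L with
      | nil => simp
      | cons j L ih =>
        have : parityHom k n (c k j) = -c k j := HC.lift_c _ j
        rw [List.map_cons, List.prod_cons, map_mul, ih, this, List.length_cons, pow_succ,
          HC.neg_mul, HC.neg_eq_smul, mul_smul_comm, smul_smul, mul_comm]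
    rw [cProd, this, Finset.length_sort]
  rw [LinearMap.comp_apply, AlgHom.toLinearMap_apply, map_mul, h₁, h₂, smul_mul_assoc, map_smul,
    hasTraceValues_trace D w l hl]
  by_cases hD : D = ∅
  · simp [hD]
  · simp [hD]

theorem trace_of_mem_parity_one {a : HC k n} (ha : a ∈ parity k n 1) : trace k n a = 0 := by
  have h := trace_parityHom a
  rw [parityHom_of_mem ha, ZMod.val_one, pow_one, map_smul, neg_one_smul] at h
  exact self_eq_neg.1 h.symm

theorem isFrobeniusTrace_trace : IsFrobeniusTrace (parity k n) (trace k n) :=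
  ⟨fun _ => trace_of_mem_parity_one, trace_no_left_ideal⟩

/-! ### The Nakayama automorphism -/

omit [CharZero k]

variable (k n) in
/-- The order-reversing twist as an endomorphism. -/
noncomputable def twistHom : HC k n →ₐ[k] HC k n := HC.lift hcRelations.twist

theorem twistHom_T (i : Fin (n - 1)) :
    twistHom k n (T k i) = T k i.rev + c k (lo i.rev) * c k (hi i.rev) := HC.lift_T _ i

theorem twistHom_c (j : Fin n) : twistHom k n (c k j) = -c k j.rev := HC.lift_c _ j

theorem twistHom_twistHom (x : HC k n) : twistHom k n (twistHom k n x) = x := by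
  induction x using HC.induction with
  | one => simp
  | add x y hx hy => simp [hx, hy]
  | smul r x hx => simp [hx]
  | T_mul i x hx =>
    have a := (hcRelations (k := k)).c_anticomm _ _ (lo_ne_hi i).symm
    have h : twistHom k n (twistHom k n (T k i)) = T k i := by
      rw [twistHom_T, map_add, map_mul, twistHom_T, twistHom_c, twistHom_c, HC.neg_mul_neg,
        Fin.rev_rev, lo_rev, hi_rev, Fin.rev_rev, Fin.rev_rev, a, add_assoc, add_neg_cancel,
        add_zero]
    rw [map_mul, map_mul, h, hx]
  | c_mul j x hx =>
    have h : twistHom k n (twistHom k n (c k j)) = c k j := by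
      rw [twistHom_c, map_neg, twistHom_c, neg_neg, Fin.rev_rev]
    rw [map_mul, map_mul, h, hx]

variable (k n) in
/-- The Nakayama automorphism. -/
noncomputable def nakayama : HC k n ≃ₐ[k] HC k n :=
  AlgEquiv.ofAlgHom (twistHom k n) (twistHom k n) (AlgHom.ext twistHom_twistHom)
    (AlgHom.ext twistHom_twistHom)

theorem nakayama_apply (x : HC k n) : nakayama k n x = twistHom k n x := rfl

theorem nakayama_gen_mem (g : Gen n) : nakayama k n (gen k g) ∈ parity k n g.deg := by
  rw [nakayama_apply]
  cases g with
  | T i =>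
    have h : twistHom k n (gen k (Gen.T i)) = _ := twistHom_T i
    rw [h]
    have h' := SetLike.GradedMul.mul_mem (gen_mem_parity k (Gen.c (lo i.rev)))
      (gen_mem_parity k (Gen.c (hi i.rev)))
    rw [Gen.deg, Gen.deg, zmod_two_one_add_one] at h'
    exact Submodule.add_mem _ (gen_mem_parity k (Gen.T i.rev)) h'
  | c j =>
    have h : twistHom k n (gen k (Gen.c j)) = _ := twistHom_c j
    rw [h, HC.neg_eq_smul]
    exact Submodule.smul_mem _ _ (gen_mem_parity k (Gen.c j.rev))

theorem nakayama_prod_mem (l : List (Gen n)) :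
    nakayama k n (l.map (gen k)).prod ∈ parity k n (l.map Gen.deg).sum := by
  induction l with
  | nil => simpa using SetLike.GradedOne.one_mem (A := parity k n)
  | cons g l ih =>
    simp only [List.map_cons, List.prod_cons, List.sum_cons, map_mul]
    exact SetLike.GradedMul.mul_mem (nakayama_gen_mem g) ih

variable [CharZero k]

/-- For `c p` the minus sign in the twist matches the super sign when `a` is odd; when `a` is even,
`a * c p` is odd and both sides vanish. -/
theorem trace_mul_gen (g : Gen n) {i : ZMod 2} {a : HC k n} (ha : a ∈ parity k n i) :
    trace k n (a * gen k g) =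
      (-1 : k) ^ (i.val * g.deg.val) * trace k n (nakayama k n (gen k g) * a) := by
  rw [nakayama_apply]
  cases g with
  | T p =>
    have h : twistHom k n (gen k (Gen.T p)) = _ := twistHom_T p
    rw [h, ← trace_mul_T]
    simp [Gen.deg, T]
  | c p =>
    have h : twistHom k n (gen k (Gen.c p)) = _ := twistHom_c p
    rw [h, HC.neg_mul, map_neg, ← trace_mul_c]
    rcases zmod_two_cases i with rfl | rfl
    · have : trace k n (a * gen k (Gen.c p)) = 0 :=
        trace_of_mem_parity_one (by
          simpa [Gen.deg] using SetLike.GradedMul.mul_mem ha (gen_mem_parity k (Gen.c p)))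
      simp [c, this]
    · simp [Gen.deg, c, ZMod.val_one]

omit [CharZero k] in
theorem nakayama_sign (i d m : ZMod 2) :
    (-1 : k) ^ ((i + d).val * m.val) * (-1) ^ ((m + i).val * d.val) =
      (-1) ^ (i.val * (d + m).val) := by
  rcases zmod_two_cases i with rfl | rfl <;> rcases zmod_two_cases d with rfl | rfl <;>
    rcases zmod_two_cases m with rfl | rfl <;> simp [ZMod.val_one, zmod_two_one_add_one]

/-- For a word `g l`, first `l` and then `g` is carried cyclically to the front, giving `φ(g) φ(l)
a`; `nakayama_sign` combines the two super signs. -/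
theorem trace_mul_prod (l : List (Gen n)) {i : ZMod 2} {a : HC k n} (ha : a ∈ parity k n i) :
    trace k n (a * (l.map (gen k)).prod) = (-1 : k) ^ (i.val * (l.map Gen.deg).sum.val) *
      trace k n (nakayama k n (l.map (gen k)).prod * a) := by
  induction l generalizing i a with
  | nil => simp
  | cons g l ih =>
    simp only [List.map_cons, List.prod_cons, List.sum_cons, map_mul]
    rw [← mul_assoc, ih (SetLike.GradedMul.mul_mem ha (gen_mem_parity k g)), ← mul_assoc,
      trace_mul_gen g (SetLike.GradedMul.mul_mem (nakayama_prod_mem l) ha), ← mul_assoc,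
      nakayama_sign, mul_assoc (nakayama k n _)]

theorem isNakayamaAutomorphism_nakayama :
    IsNakayamaAutomorphism (parity k n) (trace k n) (nakayama k n) where
  even i a ha := by
    induction ha using Submodule.span_induction with
    | mem a h => obtain ⟨l, rfl, rfl⟩ := h; exact nakayama_prod_mem l
    | zero => simp
    | add x y _ _ hx hy => rw [map_add]; exact add_mem hx hy
    | smul r x _ hx => rw [map_smul]; exact Submodule.smul_mem _ _ hx
  trace_mul i j a ha b hb := by
    induction hb using Submodule.span_induction with
    | mem b h => obtain ⟨l, rfl, rfl⟩ := h; exact trace_mul_prod l ha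
    | zero => simp
    | add x y _ _ hx hy => simp only [mul_add, add_mul, map_add, hx, hy]
    | smul r x _ hx =>
      simp only [mul_smul_comm, smul_mul_assoc, map_smul, hx, smul_eq_mul]
      ring

end Trace

end HeckeClifford

open HeckeClifford in
theorem proposition3p3p6 (k : Type*) [Field k] [IsAlgClosed k] [CharZero k] (n : ℕ) :
    IsFrobeniusSuperalgebra (parity k n) ∧
    ∃ tr : HC k n →ₗ[k] k,
      HasTraceValues tr ∧
      (∀ tr' : HC k n →ₗ[k] k, HasTraceValues tr' → tr' = tr) ∧
      IsFrobeniusTrace (parity k n) tr ∧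
      ∃ φ : HC k n ≃ₐ[k] HC k n,
        (∀ i : Fin (n - 1), φ (T k i) = T k i.rev + c k (lo i.rev) * c k (hi i.rev)) ∧
        (∀ j : Fin n, φ (c k j) = -c k j.rev) ∧
        (∀ x, φ (φ x) = x) ∧
        IsNakayamaAutomorphism (parity k n) tr φ :=
  ⟨⟨finiteDimensional_HC, trace k n, isFrobeniusTrace_trace⟩, trace k n, hasTraceValues_trace,
    fun _ h => eq_of_hasTraceValues h hasTraceValues_trace, isFrobeniusTrace_trace,
    nakayama k n, twistHom_T, twistHom_c, twistHom_twistHom, isNakayamaAutomorphism_nakayama⟩
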